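/- Work in the category $\mathrm{Sp}$ of symmetric spectra in pointed simplicial sets; write $X(n)$ for the $n$th level of a symmetric spectrum $X$. A cofibration of pointed simplicial sets is a monomorphism. Let $S$ be the sphere spectrum, let $\bar S$ be its subspectrum with $\bar S(0)=*$ and $\bar S(n)=S^n$ for $n\ge 1$, put $L_nX=(\bar S\wedge X)(n)$, and let $\nu_n\colon L_nX\to (S\wedge X)(n)\cong X(n)$ be the natural map induced by $\bar S\to S$. A map $f\colon X\to Y$ in $\mathrm{Sp}$ is - a *levelwise cofibration* if $f(n)\colon X(n)\to Y(n)$ is a cofibration for all $n\ge 0$; - a *flat cofibration* if $X(n)\amalg_{L_nX}L_nY\to Y(n)$ is a cofibration for all $n\ge 0$; - a *positive flat cofibration* if it is a flat cofibration and $f(0)\colon X(0)\to Y(0)$ is an isomorphism. A symmetric spectrum $X$ is (*positive*) *flat-cofibrant* if $*\to X$ is a (positive) flat cofibration. For a simplicial object $X_\bullet$ in $\mathrm{Sp}$, the latching object $\tilde L_nX_\bullet$ is the zero object for $n=0$, it is $X_0$ for $n=1$, and for $n\ge 2$ it is the coequalizer of the two maps $\coprod_{0\le i<j\le n-1}X_{n-2}\rightrightarrows\coprod_{0\le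 k\le n-1}X_{n-1}$ which on the summand $(i,j)$ are $s_i$ into the summand $j$ and $s_{j-1}$ into the summand $i$, respectively. The latching map $\tilde L_nX_\bullet\to X_n$ is the map $*\to X_0$ for $n=0$, and it is induced by the degeneracies $s_k\colon X_{n-1}\to X_n$ for $n\ge 1$. Call $X_\bullet$ *good* if each $X_n$ is flat-cofibrant and all degeneracies $s_i\colon X_n\to X_{n+1}$ are levelwise cofibrations, and *positive-good* if moreover each $X_n$ is positive flat-cofibrant. Call $X_\bullet$ *Reedy* (*positive*) *flat-cofibrant* if for every $n\ge 0$ the latching map $\tilde L_nX_\bullet\to X_n$ is a (positive) flat cofibration. **Theorem.** Let $X_\bullet$ be a good simplicial symmetric spectrum in pointed simplicial sets. Then $X_\bullet$ is Reedy flat-cofibrant. If $X_\bullet$ is moreover positive-good, then $X_\bullet$ is Reedy positive flat-cofibrant. -/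

import Mathlib

open CategoryTheory Limits Opposite

universe u

namespace SymmetricSpectra

/-! ### Pointed simplicial sets -/

/-- The category of pointed simplicial sets. -/
abbrev PSSet : Type (u + 1) := SimplicialObject Pointed.{u}

namespace PSSet

/-- The simplices of a pointed simplicial set in a given degree. -/
abbrev El (A : PSSet.{u}) (m : SimplexCategoryᵒᵖ) : Type u := (A.obj m).X

/-- The basepoint in a given degree. -/
abbrev pt (A : PSSet.{u}) (m : SimplexCategoryᵒᵖ) : A.El m := (A.obj m).point

/-- The action of a simplicial operator on simplices. -/
abbrev res (A : PSSet.{u}) {m m' : SimplexCategoryᵒᵖ} (θ : m ⟶ m') : A.El m → A.El m' :=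
  (A.map θ).toFun

/-- The effect of a map of pointed simplicial sets on simplices. -/
abbrev ev {A B : PSSet.{u}} (f : A ⟶ B) {m : SimplexCategoryᵒᵖ} : A.El m → B.El m :=
  (f.app m).toFun

lemma res_id (A : PSSet.{u}) (m : SimplexCategoryᵒᵖ) (x : A.El m) : A.res (𝟙 m) x = x := by
  simp [res]

lemma res_comp (A : PSSet.{u}) {m m' m'' : SimplexCategoryᵒᵖ} (θ : m ⟶ m') (η : m' ⟶ m'')
    (x : A.El m) : A.res (θ ≫ η) x = A.res η (A.res θ x) := by
  simp [res]

lemma res_pt (A : PSSet.{u}) {m m' : SimplexCategoryᵒᵖ} (θ : m ⟶ m') :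
    A.res θ (A.pt m) = A.pt m' := (A.map θ).map_point

lemma ev_pt {A B : PSSet.{u}} (f : A ⟶ B) (m : SimplexCategoryᵒᵖ) : ev f (A.pt m) = B.pt m :=
  (f.app m).map_point

lemma ev_res {A B : PSSet.{u}} (f : A ⟶ B) {m m' : SimplexCategoryᵒᵖ} (θ : m ⟶ m')
    (x : A.El m) : ev f (A.res θ x) = B.res θ (ev f x) :=
  congrFun (congrArg Pointed.Hom.toFun (f.naturality θ)) x

lemma ev_comp {A B C : PSSet.{u}} (f : A ⟶ B) (g : B ⟶ C) {m : SimplexCategoryᵒᵖ}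
    (x : A.El m) : ev (f ≫ g) x = ev g (ev f x) := rfl

lemma ev_id {A : PSSet.{u}} {m : SimplexCategoryᵒᵖ} (x : A.El m) : ev (𝟙 A) x = x := rfl

lemma hom_ext {A B : PSSet.{u}} {f g : A ⟶ B}
    (h : ∀ (m : SimplexCategoryᵒᵖ) (x : A.El m), ev f x = ev g x) : f = g := by
  exact NatTrans.ext (funext fun m => Pointed.Hom.ext (funext (h m)))

/-- Construct a pointed simplicial set from its sets of simplices. -/
def mk' (E : SimplexCategoryᵒᵖ → Type u) (p : ∀ m, E m)
    (r : ∀ {m m' : SimplexCategoryᵒᵖ}, (m ⟶ m') → E m → E m')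
    (hp : ∀ {m m' : SimplexCategoryᵒᵖ} (θ : m ⟶ m'), r θ (p m) = p m')
    (hid : ∀ (m : SimplexCategoryᵒᵖ) (x : E m), r (𝟙 m) x = x)
    (hcomp : ∀ {m m' m'' : SimplexCategoryᵒᵖ} (θ : m ⟶ m') (η : m' ⟶ m'') (x : E m),
      r (θ ≫ η) x = r η (r θ x)) : PSSet.{u} where
  obj m := ⟨E m, p m⟩
  map θ := ⟨r θ, hp θ⟩
  map_id m := Pointed.Hom.ext (funext (hid m))
  map_comp θ η := Pointed.Hom.ext (funext (hcomp θ η))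

/-- Construct a map of pointed simplicial sets from its effect on simplices. -/
def homMk {A B : PSSet.{u}} (f : ∀ m, A.El m → B.El m) (hp : ∀ m, f m (A.pt m) = B.pt m)
    (hn : ∀ {m m' : SimplexCategoryᵒᵖ} (θ : m ⟶ m') (x : A.El m),
      f m' (A.res θ x) = B.res θ (f m x)) : A ⟶ B where
  app m := ⟨f m, hp m⟩
  naturality _ _ θ := Pointed.Hom.ext (funext (hn θ))

/-- A cofibration of pointed simplicial sets is a monomorphism,
that is, a map which is injective on the simplices of each degree. -/
def IsCofibration {A B : PSSet.{u}} (f : A ⟶ B) : Prop :=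
  ∀ m : SimplexCategoryᵒᵖ, Function.Injective (ev f : A.El m → B.El m)

/-- The relation collapsing the simplices of a subcomplex to a new basepoint `none`. -/
inductive CollapseRel (K : SSet.{u}) (A : K.Subcomplex) (m : SimplexCategoryᵒᵖ) :
    Option (K.obj m) → Option (K.obj m) → Prop
  | collapse (x : K.obj m) (hx : x ∈ A.obj m) : CollapseRel K A m (some x) none

/-- The quotient `K / A` of a simplicial set by a subcomplex, pointed by the image of `A`
(with a disjoint basepoint added if `A` is empty). -/
def collapse (K : SSet.{u}) (A : K.Subcomplex) : PSSet.{u} :=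
  mk' (fun m => Quot (CollapseRel K A m)) (fun _ => Quot.mk _ none)
    (fun {m m'} θ => Quot.map (Option.map (K.map θ)) (by
      rintro _ _ ⟨x, hx⟩
      exact .collapse _ (A.map θ hx)))
    (fun _ => rfl)
    (by rintro m ⟨_ | x⟩ <;> simp [Quot.map])
    (by rintro m m' m'' θ η ⟨_ | x⟩ <;> simp [Quot.map])

/-- The simplex of `K / A` represented by a simplex of `K`. -/
def collapse.mk {K : SSet.{u}} {A : K.Subcomplex} {m : SimplexCategoryᵒᵖ} (x : K.obj m) :
    (collapse K A).El m := Quot.mk _ (some x)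

lemma collapse.mk_eq_pt {K : SSet.{u}} {A : K.Subcomplex} {m : SimplexCategoryᵒᵖ}
    {x : K.obj m} (hx : x ∈ A.obj m) : (collapse.mk x : (collapse K A).El m) = pt _ m :=
  Quot.sound (.collapse x hx)

lemma collapse.res_mk {K : SSet.{u}} {A : K.Subcomplex} {m m' : SimplexCategoryᵒᵖ}
    (θ : m ⟶ m') (x : K.obj m) :
    (collapse K A).res θ (collapse.mk x) = collapse.mk (K.map θ x) := rfl

lemma collapse.ind {K : SSet.{u}} {A : K.Subcomplex} {m : SimplexCategoryᵒᵖ}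
    {P : (collapse K A).El m → Prop} (h0 : P (pt _ m)) (h1 : ∀ x, P (collapse.mk x))
    (z : (collapse K A).El m) : P z := by
  obtain ⟨_ | x⟩ := z
  · exact h0
  · exact h1 x

/-- A function on the simplices of `K` which is constant on `A` descends to `K / A`. -/
def collapse.lift {K : SSet.{u}} {A : K.Subcomplex} {m : SimplexCategoryᵒᵖ} {T : Type*}
    (f : K.obj m → T) (t : T) (h : ∀ x ∈ A.obj m, f x = t) : (collapse K A).El m → T :=
  Quot.lift (fun o => o.elim t f) (by rintro _ _ ⟨x, hx⟩; exact h x hx)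

open Simplicial in
/-- The simplicial circle `Δ[1] / ∂Δ[1]`. -/
def circle : PSSet.{u} := collapse Δ[1] ∂Δ[1]

/-- The cartesian product of the underlying simplicial sets. -/
def prodSSet (A B : PSSet.{u}) : SSet.{u} where
  obj m := A.El m × B.El m
  map θ := ↾(Prod.map (A.res θ) (B.res θ))
  map_id m := by
    ext ⟨x, y⟩
    exacts [res_id _ _ _, res_id _ _ _]
  map_comp θ η := by
    ext ⟨x, y⟩
    exacts [res_comp _ _ _ _, res_comp _ _ _ _]

/-- The wedge `A ∨ B` inside the product. -/
def wedge (A B : PSSet.{u}) : (prodSSet A B).Subcomplex where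
  obj m := {z : A.El m × B.El m | z.1 = A.pt m ∨ z.2 = B.pt m}
  map {m m'} θ := by
    rintro ⟨x, y⟩ (h | h)
    · exact Or.inl ((congrArg (A.res θ) h).trans (A.res_pt θ))
    · exact Or.inr ((congrArg (B.res θ) h).trans (B.res_pt θ))

/-- The smash product `A ∧ B = (A × B) / (A ∨ B)` of pointed simplicial sets. -/
def smash (A B : PSSet.{u}) : PSSet.{u} := collapse (prodSSet A B) (wedge A B)

/-- The simplex `x ∧ y` of a smash product. -/
def smash.mk {A B : PSSet.{u}} {m : SimplexCategoryᵒᵖ} (x : A.El m) (y : B.El m) :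
    (smash A B).El m := collapse.mk (A := wedge A B) ((x, y) : A.El m × B.El m)

lemma smash.mk_pt_left {A B : PSSet.{u}} {m : SimplexCategoryᵒᵖ} (y : B.El m) :
    smash.mk (A.pt m) y = pt _ m := collapse.mk_eq_pt (Or.inl rfl)

lemma smash.mk_pt_right {A B : PSSet.{u}} {m : SimplexCategoryᵒᵖ} (x : A.El m) :
    smash.mk x (B.pt m) = pt _ m := collapse.mk_eq_pt (Or.inr rfl)

lemma smash.res_mk {A B : PSSet.{u}} {m m' : SimplexCategoryᵒᵖ} (θ : m ⟶ m')
    (x : A.El m) (y : B.El m) :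
    (smash A B).res θ (smash.mk x y) = smash.mk (A.res θ x) (B.res θ y) := rfl

/-- A simplicial map on `A × B` which sends `A ∨ B` to the basepoint descends to `A ∧ B`. -/
def smash.desc {A B C : PSSet.{u}} (f : ∀ m, A.El m → B.El m → C.El m)
    (hl : ∀ m y, f m (A.pt m) y = C.pt m) (hr : ∀ m x, f m x (B.pt m) = C.pt m)
    (hn : ∀ {m m' : SimplexCategoryᵒᵖ} (θ : m ⟶ m') (x : A.El m) (y : B.El m),
      f m' (A.res θ x) (B.res θ y) = C.res θ (f m x y)) : smash A B ⟶ C :=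
  homMk (fun m => collapse.lift (fun z : A.El m × B.El m => f m z.1 z.2) (C.pt m) (by
      rintro ⟨x, y⟩ (h | h)
      · exact (congrArg (fun x => f m x y) h).trans (hl m y)
      · exact (congrArg (fun y => f m x y) h).trans (hr m x)))
    (fun _ => rfl)
    (fun {m m'} θ z => by
      induction z using collapse.ind with
      | h0 => exact (C.res_pt θ).symm
      | h1 z => exact hn θ z.1 z.2)

lemma smash.desc_mk {A B C : PSSet.{u}} (f : ∀ m, A.El m → B.El m → C.El m) (hl hr)
    (hn : ∀ {m m' : SimplexCategoryᵒᵖ} (θ : m ⟶ m') (x : A.El m) (y : B.El m),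
      f m' (A.res θ x) (B.res θ y) = C.res θ (f m x y)) {m : SimplexCategoryᵒᵖ}
    (x : A.El m) (y : B.El m) : ev (smash.desc f hl hr hn) (smash.mk x y) = f m x y := rfl

/-- The `k`-fold power of the underlying simplicial set of the circle. -/
def torus (k : ℕ) : SSet.{u} where
  obj m := Fin k → circle.{u}.El m
  map θ := ↾(fun t i => circle.res θ (t i))
  map_id m := ConcreteCategory.hom_ext _ _ fun t =>
    (funext fun i => circle.res_id m (t i) : (fun i => circle.res (𝟙 m) (t i)) = t)
  map_comp θ η := ConcreteCategory.hom_ext _ _ fun t =>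
    (funext fun i => circle.res_comp θ η (t i) : (fun i => circle.res (θ ≫ η) (t i)) =
      fun i => circle.res η (circle.res θ (t i)))

/-- The fat wedge: the tuples with at least one coordinate at the basepoint. -/
def fatWedge (k : ℕ) : (torus.{u} k).Subcomplex where
  obj m := {t : Fin k → circle.{u}.El m | ∃ i, t i = circle.pt m}
  map {m m'} θ := by
    rintro t ⟨i, h⟩
    exact ⟨i, (congrArg (circle.res θ) h).trans (circle.res_pt θ)⟩

/-- The sphere `S^k`, the `k`-fold smash power of the circle; `S^0` has two points. -/
def sphere (k : ℕ) : PSSet.{u} := collapse (torus k) (fatWedge k)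

/-- The simplex `t 0 ∧ ... ∧ t (k - 1)` of the sphere `S^k`. -/
def sphere.mk {k : ℕ} {m : SimplexCategoryᵒᵖ} (t : Fin k → circle.{u}.El m) :
    (sphere.{u} k).El m := collapse.mk (A := fatWedge k) t

lemma sphere.mk_eq_pt {k : ℕ} {m : SimplexCategoryᵒᵖ} (t : Fin k → circle.{u}.El m) (i : Fin k)
    (h : t i = circle.pt m) : sphere.mk t = pt _ m := collapse.mk_eq_pt ⟨i, h⟩

lemma sphere.ind {k : ℕ} {m : SimplexCategoryᵒᵖ} {P : (sphere.{u} k).El m → Prop}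
    (h0 : P (pt _ m)) (h1 : ∀ t, P (sphere.mk t)) (z : (sphere.{u} k).El m) : P z :=
  collapse.ind h0 h1 z

lemma sphere.res_mk {k : ℕ} {m m' : SimplexCategoryᵒᵖ} (θ : m ⟶ m')
    (t : Fin k → circle.{u}.El m) :
    (sphere k).res θ (sphere.mk t) = sphere.mk (fun i => circle.res θ (t i)) := rfl

/-- A function on `k`-tuples which is constant on the fat wedge descends to the sphere. -/
def sphere.lift {k : ℕ} {m : SimplexCategoryᵒᵖ} {T : Type*} (f : (Fin k → circle.{u}.El m) → T)
    (p : T) (h : ∀ t i, t i = circle.pt m → f t = p) : (sphere.{u} k).El m → T :=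
  collapse.lift f p (fun t ⟨i, hi⟩ => h t i hi)

end PSSet


/-! ### Symmetric spectra -/

open PSSet

/-- The block permutation `α ⊕ β` of `n + k` letters. -/
def blockPerm {n k : ℕ} (α : Equiv.Perm (Fin n)) (β : Equiv.Perm (Fin k)) :
    Equiv.Perm (Fin (n + k)) :=
  finSumFinEquiv.permCongr (Equiv.sumCongr α β)

/-- The iterated structure map `X_n ∧ S^k → X_{n+k}`, evaluated on `x ∧ (t 0 ∧ ... ∧ t (k - 1))`. -/
def iterStr {lvl : ℕ → PSSet.{u}} (str : ∀ n, smash (lvl n) circle ⟶ lvl (n + 1))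
    {n : ℕ} {m : SimplexCategoryᵒᵖ} (x : (lvl n).El m) :
    ∀ k : ℕ, (Fin k → circle.{u}.El m) → (lvl (n + k)).El m
  | 0, _ => x
  | k + 1, t => ev (str (n + k))
      (smash.mk (iterStr str x k (fun i => t i.castSucc)) (t (Fin.last k)))

/-- A symmetric spectrum in pointed simplicial sets: pointed simplicial sets `X_n` with a
basepoint-preserving left action of the symmetric group on `n` letters, and structure maps
`X_n ∧ S^1 → X_{n+1}`, such that each iterated structure map `X_n ∧ S^k → X_{n+k}` is
equivariant for the product of the symmetric groups on `n` and on `k` letters. The group acts on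
`S^k = S^1 ∧ ... ∧ S^1` by permuting the factors, `(β • t) i = t (β⁻¹ i)`. -/
structure SymSpec : Type (u + 1) where
  /-- the pointed simplicial set in level `n` -/
  lvl : ℕ → PSSet.{u}
  /-- the action of the symmetric group -/
  act : ∀ n : ℕ, Equiv.Perm (Fin n) →* End (lvl n)
  /-- the structure maps -/
  str : ∀ n : ℕ, smash (lvl n) circle ⟶ lvl (n + 1)
  equivariant : ∀ (n k : ℕ) (α : Equiv.Perm (Fin n)) (β : Equiv.Perm (Fin k))
    (m : SimplexCategoryᵒᵖ) (x : (lvl n).El m) (t : Fin k → circle.{u}.El m),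
    iterStr str (ev (act n α) x) k (fun i => t (β⁻¹ i)) =
      ev (act (n + k) (blockPerm α β)) (iterStr str x k t)

namespace SymSpec

/-- The action of a permutation on the simplices of a level. -/
abbrev perm (X : SymSpec.{u}) {n : ℕ} {m : SimplexCategoryᵒᵖ} (α : Equiv.Perm (Fin n))
    (x : (X.lvl n).El m) : (X.lvl n).El m := ev (X.act n α) x

/-- The structure map on simplices. -/
abbrev sus (X : SymSpec.{u}) {n : ℕ} {m : SimplexCategoryᵒᵖ} (x : (X.lvl n).El m)
    (t : circle.{u}.El m) : (X.lvl (n + 1)).El m := ev (X.str n) (smash.mk x t)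

/-- The iterated structure map on simplices. -/
abbrev iter (X : SymSpec.{u}) {n : ℕ} {m : SimplexCategoryᵒᵖ} (x : (X.lvl n).El m) (k : ℕ)
    (t : Fin k → circle.{u}.El m) : (X.lvl (n + k)).El m := iterStr X.str x k t

lemma perm_one (X : SymSpec.{u}) {n : ℕ} {m : SimplexCategoryᵒᵖ} (x : (X.lvl n).El m) :
    X.perm 1 x = x := by
  simp only [perm, map_one]
  rfl

lemma perm_mul (X : SymSpec.{u}) {n : ℕ} {m : SimplexCategoryᵒᵖ} (α β : Equiv.Perm (Fin n))
    (x : (X.lvl n).El m) : X.perm (α * β) x = X.perm α (X.perm β x) := by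
  simp only [perm, map_mul]
  rfl

lemma perm_pt (X : SymSpec.{u}) {n : ℕ} {m : SimplexCategoryᵒᵖ} (α : Equiv.Perm (Fin n)) :
    X.perm α ((X.lvl n).pt m) = (X.lvl n).pt m := ev_pt _ _

lemma perm_res (X : SymSpec.{u}) {n : ℕ} {m m' : SimplexCategoryᵒᵖ} (α : Equiv.Perm (Fin n))
    (θ : m ⟶ m') (x : (X.lvl n).El m) :
    X.perm α ((X.lvl n).res θ x) = (X.lvl n).res θ (X.perm α x) := ev_res _ _ _

lemma sus_pt_left (X : SymSpec.{u}) {n : ℕ} {m : SimplexCategoryᵒᵖ} (t : circle.{u}.El m) :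
    X.sus ((X.lvl n).pt m) t = (X.lvl (n + 1)).pt m := by
  rw [sus, smash.mk_pt_left, ev_pt]

lemma sus_pt_right (X : SymSpec.{u}) {n : ℕ} {m : SimplexCategoryᵒᵖ} (x : (X.lvl n).El m) :
    X.sus x (circle.pt m) = (X.lvl (n + 1)).pt m := by
  rw [sus, smash.mk_pt_right, ev_pt]

lemma sus_res (X : SymSpec.{u}) {n : ℕ} {m m' : SimplexCategoryᵒᵖ} (θ : m ⟶ m')
    (x : (X.lvl n).El m) (t : circle.{u}.El m) :
    X.sus ((X.lvl n).res θ x) (circle.res θ t) = (X.lvl (n + 1)).res θ (X.sus x t) := by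
  rw [sus, ← smash.res_mk, ev_res]

lemma iter_pt_left (X : SymSpec.{u}) {n : ℕ} {m : SimplexCategoryᵒᵖ} (k : ℕ)
    (t : Fin k → circle.{u}.El m) :
    X.iter ((X.lvl n).pt m) k t = (X.lvl (n + k)).pt m := by
  induction k with
  | zero => rfl
  | succ k ih =>
    change X.sus (X.iter _ k _) _ = _
    rw [ih, sus_pt_left]
    rfl

lemma iter_pt_right (X : SymSpec.{u}) {n : ℕ} {m : SimplexCategoryᵒᵖ} (x : (X.lvl n).El m)
    (k : ℕ) (t : Fin k → circle.{u}.El m) (i : Fin k) (h : t i = circle.pt m) :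
    X.iter x k t = (X.lvl (n + k)).pt m := by
  induction k with
  | zero => exact i.elim0
  | succ k ih =>
    change X.sus (X.iter _ k _) _ = _
    induction i using Fin.lastCases with
    | last => rw [h, sus_pt_right]; rfl
    | cast i => rw [ih _ i h, sus_pt_left]; rfl

lemma iter_res (X : SymSpec.{u}) {n : ℕ} {m m' : SimplexCategoryᵒᵖ} (θ : m ⟶ m')
    (x : (X.lvl n).El m) (k : ℕ) (t : Fin k → circle.{u}.El m) :
    X.iter ((X.lvl n).res θ x) k (fun i => circle.res θ (t i)) =
      (X.lvl (n + k)).res θ (X.iter x k t) := by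
  induction k with
  | zero => rfl
  | succ k ih =>
    change X.sus (X.iter _ k _) _ = _
    rw [ih, sus_res]
    rfl

/-- A map of symmetric spectra: level maps which are equivariant and commute with the structure
maps. -/
@[ext]
structure Hom (X Y : SymSpec.{u}) : Type u where
  /-- the map in level `n` -/
  app : ∀ n : ℕ, X.lvl n ⟶ Y.lvl n
  app_perm : ∀ (n : ℕ) (α : Equiv.Perm (Fin n)) (m : SimplexCategoryᵒᵖ) (x : (X.lvl n).El m),
    ev (app n) (X.perm α x) = Y.perm α (ev (app n) x)
  app_sus : ∀ (n : ℕ) (m : SimplexCategoryᵒᵖ) (x : (X.lvl n).El m) (t : circle.{u}.El m),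
    ev (app (n + 1)) (X.sus x t) = Y.sus (ev (app n) x) t

instance : Category.{u} SymSpec.{u} where
  Hom := Hom
  id X := ⟨fun _ => 𝟙 _, fun _ _ _ _ => rfl, fun _ _ _ _ => rfl⟩
  comp f g := ⟨fun n => f.app n ≫ g.app n,
    fun n α m x => by rw [ev_comp, f.app_perm, g.app_perm, ev_comp],
    fun n m x t => by rw [ev_comp, f.app_sus, g.app_sus, ev_comp]⟩

lemma hom_ext {X Y : SymSpec.{u}} {f g : X ⟶ Y} (h : ∀ n, Hom.app f n = Hom.app g n) : f = g :=
  Hom.ext (funext h)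

/-- The functor sending a symmetric spectrum to its level `n`. -/
def level (n : ℕ) : SymSpec.{u} ⥤ PSSet.{u} where
  obj X := X.lvl n
  map f := Hom.app f n
  map_id _ := rfl
  map_comp _ _ := rfl

lemma app_iter {X Y : SymSpec.{u}} (f : X ⟶ Y) {n : ℕ} {m : SimplexCategoryᵒᵖ}
    (x : (X.lvl n).El m) (k : ℕ) (t : Fin k → circle.{u}.El m) :
    ev (Hom.app f (n + k)) (X.iter x k t) = Y.iter (ev (Hom.app f n) x) k t := by
  induction k with
  | zero => rfl
  | succ k ih =>
    change ev (Hom.app f (n + k + 1)) (X.sus (X.iter _ k _) _) = Y.sus (Y.iter _ k _) _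
    rw [Hom.app_sus, ih]

/-! #### The zero object and colimits -/

/-- The trivial symmetric spectrum, a point in each level. -/
def trivial : SymSpec.{u} where
  lvl _ := PSSet.mk' (fun _ => PUnit) (fun _ => PUnit.unit) (fun _ _ => PUnit.unit)
    (fun _ => rfl) (fun _ _ => rfl) (fun _ _ _ => rfl)
  act _ := 1
  str _ := homMk (fun _ _ => PUnit.unit) (fun _ => rfl) (fun _ _ => rfl)
  equivariant _ _ _ _ _ _ _ := rfl

lemma isZero_trivial : IsZero trivial.{u} where
  unique_to Y := ⟨⟨⟨⟨fun n => homMk (fun m _ => (Y.lvl n).pt m) (fun _ => rfl)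
      (fun θ _ => ((Y.lvl n).res_pt θ).symm), fun _ α _ _ => (Y.perm_pt α).symm,
      fun _ _ _ t => (Y.sus_pt_left t).symm⟩⟩, fun f => hom_ext fun n => PSSet.hom_ext
        fun m _ => ev_pt (Hom.app f n) m⟩⟩
  unique_from _ := ⟨⟨⟨⟨fun _ => homMk (fun _ _ => PUnit.unit) (fun _ => rfl)
      (fun _ _ => rfl), fun _ _ _ _ => rfl, fun _ _ _ _ => rfl⟩⟩, fun _ => rfl⟩⟩

instance : HasZeroObject SymSpec.{u} := ⟨⟨trivial, isZero_trivial⟩⟩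

end SymSpec

/-! ### Existence of colimits -/

section Colimits

variable {J : Type u} [SmallCategory J]

/-- The identifications made in the colimit of a diagram of pointed sets; `none` is the
basepoint. -/
inductive ColimRel (G : J ⥤ Pointed.{u}) :
    Option (Σ j, (G.obj j).X) → Option (Σ j, (G.obj j).X) → Prop
  | map {i j : J} (f : i ⟶ j) (x : (G.obj i).X) :
      ColimRel G (some ⟨i, x⟩) (some ⟨j, (G.map f).toFun x⟩)
  | base (j : J) : ColimRel G (some ⟨j, (G.obj j).point⟩) none

/-- The colimit of a diagram of pointed sets. -/
def colimPt (G : J ⥤ Pointed.{u}) : Pointed.{u} := ⟨Quot (ColimRel G), Quot.mk _ none⟩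

/-- The coprojections into the colimit of a diagram of pointed sets. -/
def colimPt.ι (G : J ⥤ Pointed.{u}) (j : J) : G.obj j ⟶ colimPt G :=
  ⟨fun x => Quot.mk _ (some ⟨j, x⟩), Quot.sound (.base j)⟩

lemma colimPt.w (G : J ⥤ Pointed.{u}) {i j : J} (f : i ⟶ j) (x : (G.obj i).X) :
    (colimPt.ι G j).toFun ((G.map f).toFun x) = (colimPt.ι G i).toFun x :=
  (Quot.sound (.map f x)).symm

lemma colimPt.ind {G : J ⥤ Pointed.{u}} {P : (colimPt G).X → Prop} (h0 : P (colimPt G).point)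
    (h1 : ∀ j x, P ((colimPt.ι G j).toFun x)) (z : (colimPt G).X) : P z := by
  obtain ⟨_ | ⟨j, x⟩⟩ := z
  · exact h0
  · exact h1 j x

/-- The map out of the colimit of a diagram of pointed sets induced by a cocone. -/
def colimPt.desc {G : J ⥤ Pointed.{u}} {T : Pointed.{u}} (f : ∀ j, (G.obj j).X → T.X)
    (hp : ∀ j, f j (G.obj j).point = T.point)
    (hw : ∀ {i j : J} (g : i ⟶ j) (x : (G.obj i).X), f j ((G.map g).toFun x) = f i x) :
    colimPt G ⟶ T :=
  ⟨Quot.lift (fun o => o.elim T.point fun x => f x.1 x.2) (by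
    rintro _ _ (⟨g, x⟩ | j)
    · exact (hw g x).symm
    · exact hp j), rfl⟩

instance : HasColimits Pointed.{u} where
  has_colimits_of_shape J _ := ⟨fun G => ⟨⟨{
    cocone := ⟨colimPt G, ⟨fun j => colimPt.ι G j, fun _ _ f =>
      Pointed.Hom.ext (funext fun x => colimPt.w G f x)⟩⟩
    isColimit := {
      desc := fun s => colimPt.desc (fun j => (s.ι.app j).toFun) (fun j => (s.ι.app j).map_point)
        (fun g x => congrFun (congrArg Pointed.Hom.toFun (s.w g)) x)
      fac := fun s j => rfl
      uniq := fun s f h => by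
        refine Pointed.Hom.ext (funext fun z => ?_)
        induction z using colimPt.ind with
        | h0 => exact f.map_point
        | h1 j x => exact congrFun (congrArg Pointed.Hom.toFun (h j)) x } }⟩⟩⟩

variable (F : J ⥤ SymSpec.{u})

/-- The diagram of pointed sets of simplices in a fixed level and degree. -/
abbrev elDiag (n : ℕ) (m : SimplexCategoryᵒᵖ) : J ⥤ Pointed.{u} :=
  F ⋙ SymSpec.level n ⋙ (evaluation _ _).obj m

/-- Level `n` of the colimit of a diagram of symmetric spectra, formed degreewise. -/
def colimLvl (n : ℕ) : PSSet.{u} where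
  obj m := colimPt (elDiag F n m)
  map {m m'} θ := colimPt.desc
    (fun j x => (colimPt.ι (elDiag F n m') j).toFun (((F.obj j).lvl n).res θ x))
    (fun j => (congrArg (colimPt.ι (elDiag F n m') j).toFun (((F.obj j).lvl n).res_pt θ)).trans
      (colimPt.ι (elDiag F n m') j).map_point)
    (fun {i j} g x => (congrArg (colimPt.ι (elDiag F n m') j).toFun
      (ev_res (SymSpec.Hom.app (F.map g) n) θ x).symm).trans (colimPt.w (elDiag F n m') g
        (((F.obj i).lvl n).res θ x)))
  map_id m := by
    refine Pointed.Hom.ext (funext fun z => ?_)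
    induction z using colimPt.ind with
    | h0 => rfl
    | h1 j x => exact congrArg (colimPt.ι (elDiag F n m) j).toFun (res_id _ _ _)
  map_comp {m m' m''} θ η := by
    refine Pointed.Hom.ext (funext fun z => ?_)
    induction z using colimPt.ind with
    | h0 => rfl
    | h1 j x => exact congrArg (colimPt.ι (elDiag F n m'') j).toFun (res_comp _ _ _ _)

/-- The coprojections into level `n` of the colimit. -/
def colimLvl.ι (n : ℕ) (j : J) : (F.obj j).lvl n ⟶ colimLvl F n :=
  homMk (fun m x => (colimPt.ι (elDiag F n m) j).toFun x)
    (fun m => (colimPt.ι (elDiag F n m) j).map_point) (fun _ _ => rfl)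

variable {F}

lemma colimLvl.w {n : ℕ} {m : SimplexCategoryᵒᵖ} {i j : J} (g : i ⟶ j)
    (x : ((F.obj i).lvl n).El m) :
    ev (colimLvl.ι F n j) (ev (SymSpec.Hom.app (F.map g) n) x) = ev (colimLvl.ι F n i) x :=
  colimPt.w (elDiag F n m) g x

lemma colimLvl.ind {n : ℕ} {m : SimplexCategoryᵒᵖ} {P : (colimLvl F n).El m → Prop}
    (h0 : P ((colimLvl F n).pt m)) (h1 : ∀ j x, P (ev (colimLvl.ι F n j) x))
    (z : (colimLvl F n).El m) : P z :=
  colimPt.ind (G := elDiag F n m) h0 h1 z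

/-- The map out of level `n` of the colimit induced by compatible maps. -/
def colimLvl.desc {n : ℕ} {T : PSSet.{u}} (f : ∀ j, (F.obj j).lvl n ⟶ T)
    (hw : ∀ {i j : J} (g : i ⟶ j) (m : SimplexCategoryᵒᵖ) (x : ((F.obj i).lvl n).El m),
      ev (f j) (ev (SymSpec.Hom.app (F.map g) n) x) = ev (f i) x) : colimLvl F n ⟶ T where
  app m := colimPt.desc (G := elDiag F n m) (fun j x => ev (f j) x) (fun j => ev_pt (f j) m)
    (fun g x => hw g m x)
  naturality {m m'} θ := by
    refine Pointed.Hom.ext (funext fun z => ?_)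
    induction z using colimLvl.ind with
    | h0 => exact (T.res_pt θ).symm
    | h1 j x => exact ev_res (f j) θ x

/-- The structure maps of the colimit of a diagram of symmetric spectra. -/
def colimStr (F : J ⥤ SymSpec.{u}) (n : ℕ) : smash (colimLvl F n) circle ⟶ colimLvl F (n + 1) :=
  smash.desc
    (fun m z t => (colimPt.desc (G := elDiag F n m) (T := (colimLvl F (n + 1)).obj m)
      (fun j x => ev (colimLvl.ι F (n + 1) j) ((F.obj j).sus x t))
      (fun j => (congrArg _ ((F.obj j).sus_pt_left t)).trans (ev_pt _ _))
      (fun {i j} g x => by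
        rw [← colimLvl.w g]
        exact congrArg _ (SymSpec.Hom.app_sus (F.map g) n m x t).symm)).toFun z)
    (fun _ _ => rfl)
    (fun m z => by
      induction z using colimLvl.ind with
      | h0 => rfl
      | h1 j x => exact (congrArg (ev (colimLvl.ι F (n + 1) j))
        ((F.obj j).sus_pt_right x)).trans (ev_pt (colimLvl.ι F (n + 1) j) m))
    (fun {m m'} θ z t => by
      induction z using colimLvl.ind with
      | h0 => rfl
      | h1 j x => exact congrArg (ev (colimLvl.ι F (n + 1) j)) ((F.obj j).sus_res θ x t))

lemma colimStr_iter {n : ℕ} {m : SimplexCategoryᵒᵖ} (j : J) (x : ((F.obj j).lvl n).El m) (k : ℕ)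
    (t : Fin k → circle.{u}.El m) :
    iterStr (colimStr F) (ev (colimLvl.ι F n j) x) k t =
      ev (colimLvl.ι F (n + k) j) ((F.obj j).iter x k t) := by
  induction k with
  | zero => rfl
  | succ k ih =>
    change ev (colimStr F (n + k)) (smash.mk (iterStr (colimStr F) _ k _) _) = _
    rw [ih]
    rfl

lemma colimStr_iter_pt {n : ℕ} {m : SimplexCategoryᵒᵖ} (k : ℕ) (t : Fin k → circle.{u}.El m) :
    iterStr (colimStr F) ((colimLvl F n).pt m) k t = (colimLvl F (n + k)).pt m := by
  induction k with
  | zero => rfl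
  | succ k ih =>
    change ev (colimStr F (n + k)) (smash.mk (iterStr (colimStr F) _ k _) _) = _
    rw [ih]
    rfl

/-- The symmetric group action on the colimit of a diagram of symmetric spectra. -/
def colimAct (F : J ⥤ SymSpec.{u}) (n : ℕ) : Equiv.Perm (Fin n) →* End (colimLvl F n) where
  toFun α := colimLvl.desc (fun j => (F.obj j).act n α ≫ colimLvl.ι F n j) (fun {i j} g m x => by
    rw [ev_comp, ev_comp, ← colimLvl.w g]
    exact congrArg _ (SymSpec.Hom.app_perm (F.map g) n α m x).symm)
  map_one' := by
    refine PSSet.hom_ext fun m z => ?_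
    induction z using colimLvl.ind with
    | h0 => rfl
    | h1 j x => exact congrArg (ev (colimLvl.ι F n j)) ((F.obj j).perm_one x)
  map_mul' α β := by
    refine PSSet.hom_ext fun m z => ?_
    induction z using colimLvl.ind with
    | h0 => rfl
    | h1 j x => exact congrArg (ev (colimLvl.ι F n j)) ((F.obj j).perm_mul α β x)

/-- The colimit of a diagram of symmetric spectra, formed levelwise and degreewise. -/
def colimSpec (F : J ⥤ SymSpec.{u}) : SymSpec.{u} where
  lvl := colimLvl F
  act := colimAct F
  str := colimStr F
  equivariant n k α β m z t := by
    induction z using colimLvl.ind with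
    | h0 => rw [ev_pt, colimStr_iter_pt, colimStr_iter_pt, ev_pt]
    | h1 j x =>
      have h : ev (colimAct F n α) (ev (colimLvl.ι F n j) x) =
        ev (colimLvl.ι F n j) ((F.obj j).perm α x) := rfl
      rw [h, colimStr_iter, colimStr_iter]
      exact congrArg (ev (colimLvl.ι F (n + k) j)) ((F.obj j).equivariant n k α β m x t)

instance : HasColimits SymSpec.{u} where
  has_colimits_of_shape J _ := ⟨fun F => ⟨⟨{
    cocone := ⟨colimSpec F, ⟨fun j => ⟨fun n => colimLvl.ι F n j, fun _ _ _ _ => rfl,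
      fun _ _ _ _ => rfl⟩, fun i j g => SymSpec.hom_ext fun n => PSSet.hom_ext fun m x =>
        colimLvl.w g x⟩⟩
    isColimit := {
      desc := fun s => ⟨fun n => colimLvl.desc (fun j => SymSpec.Hom.app (s.ι.app j) n)
          (fun g m x => congrArg (fun f => ev (SymSpec.Hom.app f n) x) (s.w g)),
        fun n α m z => by
          induction z using colimLvl.ind with
          | h0 => exact (s.pt.perm_pt α).symm
          | h1 j x => exact SymSpec.Hom.app_perm (s.ι.app j) n α m x,
        fun n m z t => by
          induction z using colimLvl.ind with
          | h0 => exact (s.pt.sus_pt_left t).symm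
          | h1 j x => exact SymSpec.Hom.app_sus (s.ι.app j) n m x t⟩
      fac := fun s j => rfl
      uniq := fun s f h => SymSpec.hom_ext fun n => PSSet.hom_ext fun m z => by
        induction z using colimLvl.ind with
        | h0 => exact ev_pt (SymSpec.Hom.app f n) m
        | h1 j x => exact congrArg (fun f => ev (SymSpec.Hom.app f n) x) (h j) } }⟩⟩⟩

end Colimits

namespace SymSpec

/-! ### The sphere spectrum and its positive part -/

/-- The symmetric group action on the sphere `S^k` permuting the smash factors. -/
def sphereAct (k : ℕ) : Equiv.Perm (Fin k) →* End (sphere.{u} k) where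
  toFun α := homMk (fun m => sphere.lift (fun t => sphere.mk fun i => t (α⁻¹ i)) (pt _ m)
      (fun t i h => sphere.mk_eq_pt _ (α i) (by simpa using h)))
    (fun _ => rfl)
    (fun θ z => by
      induction z using sphere.ind with
      | h0 => rfl
      | h1 t => rfl)
  map_one' := by
    refine PSSet.hom_ext fun m z => ?_
    induction z using sphere.ind with
    | h0 => rfl
    | h1 t => rfl
  map_mul' α β := by
    refine PSSet.hom_ext fun m z => ?_
    induction z using sphere.ind with
    | h0 => rfl
    | h1 t =>
      refine congrArg sphere.mk (funext fun i => ?_)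
      simp [mul_inv_rev]

/-- The canonical maps `S^k ∧ S^1 → S^{k+1}`. -/
def sphereStr (k : ℕ) : smash (sphere.{u} k) circle ⟶ sphere (k + 1) :=
  smash.desc
    (fun m z s => sphere.lift (fun t => sphere.mk (Fin.snoc (α := fun _ => circle.El m) t s))
      (pt _ m) (fun t i h => sphere.mk_eq_pt _ i.castSucc (by simpa using h)) z)
    (fun _ _ => rfl)
    (fun m z => by
      induction z using sphere.ind with
      | h0 => rfl
      | h1 t => exact sphere.mk_eq_pt _ (Fin.last k) (by simp))
    (fun {m m'} θ z s => by
      induction z using sphere.ind with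
      | h0 => rfl
      | h1 t =>
        refine congrArg sphere.mk (funext fun i => ?_)
        change Fin.snoc (α := fun _ => circle.El m') (fun i => circle.res θ (t i))
          (circle.res θ s) i = circle.res θ (Fin.snoc (α := fun _ => circle.El m) t s i)
        induction i using Fin.lastCases <;> simp)

lemma sphereStr_mk {k : ℕ} {m : SimplexCategoryᵒᵖ} (t : Fin k → circle.{u}.El m)
    (s : circle.{u}.El m) : ev (sphereStr k) (smash.mk (sphere.mk t) s) =
      sphere.mk (Fin.snoc (α := fun _ => circle.El m) t s) := rfl

lemma sphereStr_iter_pt {n : ℕ} {m : SimplexCategoryᵒᵖ} (k : ℕ) (t : Fin k → circle.{u}.El m) :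
    iterStr sphereStr ((sphere n).pt m) k t = (sphere (n + k)).pt m := by
  induction k with
  | zero => rfl
  | succ k ih =>
    change ev (sphereStr (n + k)) (smash.mk (iterStr sphereStr _ k _) _) = _
    rw [ih]
    rfl

lemma sphereStr_iter {n : ℕ} {m : SimplexCategoryᵒᵖ} (s : Fin n → circle.{u}.El m) (k : ℕ)
    (t : Fin k → circle.{u}.El m) :
    iterStr sphereStr (sphere.mk s) k t = sphere.mk (Fin.append s t) := by
  induction k with
  | zero =>
    refine congrArg sphere.mk (funext fun i => ?_)
    exact (Fin.append_left s t i).symm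
  | succ k ih =>
    change ev (sphereStr (n + k)) (smash.mk (iterStr sphereStr _ k _) _) = _
    rw [ih, sphereStr_mk]
    refine congrArg sphere.mk (funext fun i => ?_)
    induction i using Fin.addCases (m := n) (n := k + 1) with
    | left i =>
      rw [Fin.append_left]
      exact (Fin.snoc_castSucc (α := fun _ => circle.El m) _ _ (Fin.castAdd k i)).trans
        (Fin.append_left _ _ _)
    | right j =>
      rw [Fin.append_right]
      induction j using Fin.lastCases with
      | last => exact Fin.snoc_last (α := fun _ => circle.El m) _ _
      | cast j =>
        exact (Fin.snoc_castSucc (α := fun _ => circle.El m) _ _ (Fin.natAdd n j)).trans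
          (Fin.append_right _ _ _)

/-- The sphere spectrum `S`, with `S^k` in level `k`. -/
def sphereSpec : SymSpec.{u} where
  lvl := sphere
  act := sphereAct
  str := sphereStr
  equivariant n k α β m z t := by
    induction z using sphere.ind with
    | h0 => rw [ev_pt, sphereStr_iter_pt, sphereStr_iter_pt, ev_pt]
    | h1 s =>
      have h : ev (sphereAct n α) (sphere.mk s) = sphere.mk fun i => s (α⁻¹ i) := rfl
      rw [h, sphereStr_iter, sphereStr_iter]
      refine congrArg sphere.mk (funext fun i => ?_)
      induction i using Fin.addCases with
      | left i =>
        have : (blockPerm α β)⁻¹ (Fin.castAdd k i) = Fin.castAdd k (α⁻¹ i) := by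
          rw [Equiv.Perm.inv_eq_iff_eq]
          simp [blockPerm, Equiv.permCongr_apply]
        simp [this]
      | right j =>
        have : (blockPerm α β)⁻¹ (Fin.natAdd n j) = Fin.natAdd n (β⁻¹ j) := by
          rw [Equiv.Perm.inv_eq_iff_eq]
          simp [blockPerm, Equiv.permCongr_apply]
        simp [this]

/-- The subobject of `X_n` which is all of `X_n` if `n ≥ 1` and the basepoint if `n = 0`. -/
def posLvl (X : SymSpec.{u}) (n : ℕ) : PSSet.{u} :=
  PSSet.mk' (fun m => {x : (X.lvl n).El m // n = 0 → x = (X.lvl n).pt m})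
    (fun m => ⟨(X.lvl n).pt m, fun _ => rfl⟩)
    (fun θ x => ⟨(X.lvl n).res θ x.1, fun h => by rw [x.2 h, res_pt]⟩)
    (fun θ => Subtype.ext ((X.lvl n).res_pt θ))
    (fun _ x => Subtype.ext ((X.lvl n).res_id _ x.1))
    (fun θ η x => Subtype.ext ((X.lvl n).res_comp θ η x.1))

/-- The structure maps of the positive part. -/
def posStr (X : SymSpec.{u}) (n : ℕ) : smash (X.posLvl n) circle ⟶ X.posLvl (n + 1) :=
  smash.desc (fun _ x t => ⟨X.sus x.1 t, fun h => absurd h n.succ_ne_zero⟩)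
    (fun _ t => Subtype.ext (X.sus_pt_left t)) (fun _ x => Subtype.ext (X.sus_pt_right x.1))
    (fun θ x t => Subtype.ext (X.sus_res θ x.1 t))

lemma posStr_iter (X : SymSpec.{u}) {n : ℕ} {m : SimplexCategoryᵒᵖ} (x : (X.posLvl n).El m)
    (k : ℕ) (t : Fin k → circle.{u}.El m) :
    Subtype.val (iterStr X.posStr x k t) = X.iter x.1 k t := by
  induction k with
  | zero => rfl
  | succ k ih => exact congrArg (fun y => X.sus y (t (Fin.last k))) (ih _)

/-- The positive part of a symmetric spectrum `X`: the subspectrum which agrees with `X` in all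
levels `n ≥ 1` and is a point in level `0`. -/
def positivePart (X : SymSpec.{u}) : SymSpec.{u} where
  lvl := X.posLvl
  act n :=
    { toFun := fun α => homMk (fun _ x => ⟨X.perm α x.1, fun h => by rw [x.2 h, perm_pt]⟩)
        (fun _ => Subtype.ext (X.perm_pt α)) (fun θ x => Subtype.ext (X.perm_res α θ x.1))
      map_one' := PSSet.hom_ext fun m x => Subtype.ext (X.perm_one x.1)
      map_mul' := fun α β => PSSet.hom_ext fun m x => Subtype.ext (X.perm_mul α β x.1) }
  str := X.posStr
  equivariant n k α β m x t := Subtype.ext (by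
    refine (X.posStr_iter _ k _).trans ((X.equivariant n k α β m x.1 t).trans ?_)
    exact congrArg (X.perm (blockPerm α β)) (X.posStr_iter x k t).symm)

/-- The inclusion of the positive part. -/
def positivePartι (X : SymSpec.{u}) : X.positivePart ⟶ X where
  app _ := homMk (fun _ x => x.1) (fun _ => rfl) (fun _ _ => rfl)
  app_perm _ _ _ _ := rfl
  app_sus _ _ _ _ := rfl

/-- The spectrum `S̄`, with `S̄_0` a point and `S̄_n = S^n` for `n ≥ 1`. -/
def sphereBar : SymSpec.{u} := sphereSpec.positivePart

/-- The inclusion `S̄ → S`. -/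
def sphereBarι : sphereBar.{u} ⟶ sphereSpec := sphereSpec.positivePartι

/-! ### The smash product of symmetric spectra -/

/-- The bijection moving the last element of the right summand to the end of the left summand. -/
def moveLast (p q : ℕ) : Fin p ⊕ Fin (q + 1) ≃ Fin (p + 1) ⊕ Fin q where
  toFun := Sum.elim (fun i => Sum.inl i.castSucc)
    (Fin.lastCases (motive := fun _ => Fin (p + 1) ⊕ Fin q) (Sum.inl (Fin.last p)) Sum.inr)
  invFun := Sum.elim
    (Fin.lastCases (motive := fun _ => Fin p ⊕ Fin (q + 1)) (Sum.inr (Fin.last q)) Sum.inl)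
    (fun j => Sum.inr j.castSucc)
  left_inv := by
    rintro (i | j)
    · simp
    · induction j using Fin.lastCases <;> simp
  right_inv := by
    rintro (i | j)
    · induction i using Fin.lastCases <;> simp
    · simp

/-- Representatives `[e, x ∧ y]` for the simplices of `(X ∧ Y)_n`: simplices `x` of `X_p` and `y`
of `Y_q` together with a bijection `e` of `p + q` letters with `n` letters. -/
structure SmashGen (X Y : SymSpec.{u}) (n : ℕ) (m : SimplexCategoryᵒᵖ) : Type u where
  /-- the level of the left factor -/
  p : ℕ
  /-- the level of the right factor -/
  q : ℕ
  /-- the labelling, which encodes `p + q = n` and a permutation of `n` letters -/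
  e : Fin p ⊕ Fin q ≃ Fin n
  /-- the left factor -/
  x : (X.lvl p).El m
  /-- the right factor -/
  y : (Y.lvl q).El m

/-- The relations in `(X ∧ Y)_n`; here `none` is the basepoint. -/
inductive SmashRel (X Y : SymSpec.{u}) (n : ℕ) (m : SimplexCategoryᵒᵖ) :
    Option (SmashGen X Y n m) → Option (SmashGen X Y n m) → Prop
  | pt_left (p q : ℕ) (e : Fin p ⊕ Fin q ≃ Fin n) (y : (Y.lvl q).El m) :
      SmashRel X Y n m (some ⟨p, q, e, (X.lvl p).pt m, y⟩) none
  | pt_right (p q : ℕ) (e : Fin p ⊕ Fin q ≃ Fin n) (x : (X.lvl p).El m) :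
      SmashRel X Y n m (some ⟨p, q, e, x, (Y.lvl q).pt m⟩) none
  | perm (p q : ℕ) (e : Fin p ⊕ Fin q ≃ Fin n) (α : Equiv.Perm (Fin p)) (β : Equiv.Perm (Fin q))
      (x : (X.lvl p).El m) (y : (Y.lvl q).El m) :
      SmashRel X Y n m (some ⟨p, q, (Equiv.sumCongr α β).trans e, x, y⟩)
        (some ⟨p, q, e, X.perm α x, Y.perm β y⟩)
  | balance (p q : ℕ) (e : Fin (p + 1) ⊕ Fin q ≃ Fin n) (x : (X.lvl p).El m)
      (t : circle.{u}.El m) (y : (Y.lvl q).El m) :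
      SmashRel X Y n m (some ⟨p + 1, q, e, X.sus x t, y⟩)
        (some ⟨p, q + 1, (moveLast p q).trans e, x, Y.sus y t⟩)

/-- Apply a simplicial operator to a representative. -/
def SmashGen.res {X Y : SymSpec.{u}} {n : ℕ} {m m' : SimplexCategoryᵒᵖ} (θ : m ⟶ m')
    (g : SmashGen X Y n m) : SmashGen X Y n m' :=
  ⟨g.p, g.q, g.e, (X.lvl g.p).res θ g.x, (Y.lvl g.q).res θ g.y⟩

/-- Apply maps of spectra to a representative. -/
def SmashGen.map {X Y X' Y' : SymSpec.{u}} (f : X ⟶ X') (g : Y ⟶ Y') {n : ℕ}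
    {m : SimplexCategoryᵒᵖ} (z : SmashGen X Y n m) : SmashGen X' Y' n m :=
  ⟨z.p, z.q, z.e, ev (Hom.app f z.p) z.x, ev (Hom.app g z.q) z.y⟩

/-- Level `n` of the smash product `X ∧ Y` of symmetric spectra: the coequalizer of the two maps
from the wedge over `p + 1 + q = n` of the `(Σ_n)_+ ∧_{Σ_p × Σ_1 × Σ_q} (X_p ∧ S^1 ∧ Y_q)`
to the wedge over `p + q = n` of the `(Σ_n)_+ ∧_{Σ_p × Σ_q} (X_p ∧ Y_q)`
given by the structure maps of `X` and (after a shuffle) of `Y`. -/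
def smashLvl (X Y : SymSpec.{u}) (n : ℕ) : PSSet.{u} :=
  PSSet.mk' (fun m => Quot (SmashRel X Y n m)) (fun _ => Quot.mk _ none)
    (fun {m m'} θ => Quot.map (Option.map (SmashGen.res θ)) (by
      rintro _ _ (⟨p, q, e, y⟩ | ⟨p, q, e, x⟩ | ⟨p, q, e, α, β, x, y⟩ | ⟨p, q, e, x, t, y⟩)
      · simp only [Option.map, SmashGen.res, res_pt]
        exact .pt_left _ _ _ _
      · simp only [Option.map, SmashGen.res, res_pt]
        exact .pt_right _ _ _ _
      · simp only [Option.map, SmashGen.res, ← perm_res]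
        exact .perm _ _ _ _ _ _ _
      · simp only [Option.map, SmashGen.res, ← sus_res]
        exact .balance _ _ _ _ _ _))
    (fun _ => rfl)
    (by rintro m ⟨_ | x⟩ <;> simp [Quot.map, SmashGen.res, res_id])
    (by rintro m m' m'' θ η ⟨_ | x⟩ <;> simp [Quot.map, SmashGen.res, res_comp])

/-- The simplex of `(X ∧ Y)_n` given by a representative. -/
def smashLvl.mk {X Y : SymSpec.{u}} {n : ℕ} {m : SimplexCategoryᵒᵖ} (g : SmashGen X Y n m) :
    (smashLvl X Y n).El m := Quot.mk _ (some g)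

lemma smashLvl.ind {X Y : SymSpec.{u}} {n : ℕ} {m : SimplexCategoryᵒᵖ}
    {P : (smashLvl X Y n).El m → Prop} (h0 : P (pt _ m)) (h1 : ∀ g, P (smashLvl.mk g))
    (z : (smashLvl X Y n).El m) : P z := by
  obtain ⟨_ | x⟩ := z
  · exact h0
  · exact h1 x

/-- The functoriality of the smash product in level `n`. -/
def smashLvl.map {X Y X' Y' : SymSpec.{u}} (f : X ⟶ X') (g : Y ⟶ Y') (n : ℕ) :
    smashLvl X Y n ⟶ smashLvl X' Y' n :=
  homMk (fun m => Quot.map (Option.map (SmashGen.map f g)) (by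
      rintro _ _ (⟨p, q, e, y⟩ | ⟨p, q, e, x⟩ | ⟨p, q, e, α, β, x, y⟩ | ⟨p, q, e, x, t, y⟩)
      · simp only [Option.map, SmashGen.map, ev_pt]
        exact .pt_left _ _ _ _
      · simp only [Option.map, SmashGen.map, ev_pt]
        exact .pt_right _ _ _ _
      · simp only [Option.map, SmashGen.map, Hom.app_perm]
        exact .perm _ _ _ _ _ _ _
      · simp only [Option.map, SmashGen.map, Hom.app_sus]
        exact .balance _ _ _ _ _ _))
    (fun _ => rfl)
    (fun θ z => by
      induction z using smashLvl.ind with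
      | h0 => rfl
      | h1 z =>
        refine congrArg smashLvl.mk ?_
        simp only [SmashGen.map, SmashGen.res, ev_res])

/-! ### The action of the sphere spectrum -/

/-- The map `X_a → X_b` induced by a bijection (so that `a = b`). -/
def along (X : SymSpec.{u}) {a b : ℕ} (e : Fin a ≃ Fin b) : X.lvl a ⟶ X.lvl b :=
  have h : a = b := by simpa using Fintype.card_congr e
  X.act a (e.trans (finCongr h.symm)) ≫ eqToHom (congrArg X.lvl h)

lemma along_perm (X : SymSpec.{u}) {a : ℕ} (α : Equiv.Perm (Fin a)) :
    X.along α = X.act a α := by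
  simp only [along, eqToHom_refl, Category.comp_id]
  rfl

lemma along_trans (X : SymSpec.{u}) {a b c : ℕ} (e : Fin a ≃ Fin b) (e' : Fin b ≃ Fin c)
    {m : SimplexCategoryᵒᵖ} (x : (X.lvl a).El m) :
    ev (X.along e') (ev (X.along e) x) = ev (X.along (e.trans e')) x := by
  obtain rfl : a = b := by simpa using Fintype.card_congr e
  obtain rfl : a = c := by simpa using Fintype.card_congr e'
  rw [along_perm, along_perm, along_perm]
  exact (X.perm_mul e' e x).symm

lemma along_naturality {X Y : SymSpec.{u}} (f : X ⟶ Y) {a b : ℕ} (e : Fin a ≃ Fin b)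
    {m : SimplexCategoryᵒᵖ} (x : (X.lvl a).El m) :
    ev (Hom.app f b) (ev (X.along e) x) = ev (Y.along e) (ev (Hom.app f a) x) := by
  obtain rfl : a = b := by simpa using Fintype.card_congr e
  rw [along_perm, along_perm]
  exact Hom.app_perm f a e m x

lemma along_finCongr_sus (X : SymSpec.{u}) {a b : ℕ} (h : a = b) {m : SimplexCategoryᵒᵖ}
    (x : (X.lvl a).El m) (t : circle.{u}.El m) :
    X.sus (ev (X.along (finCongr h)) x) t =
      ev (X.along (finCongr (congrArg (· + 1) h))) (X.sus x t) := by
  subst h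
  have h1 : X.along (finCongr (rfl : a = a)) = X.act a 1 := X.along_perm 1
  have h2 : X.along (finCongr (congrArg (· + 1) (rfl : a = a))) = X.act (a + 1) 1 :=
    X.along_perm 1
  rw [h1, h2]
  exact (congrArg (fun y => X.sus y t) (X.perm_one x)).trans (X.perm_one _).symm

lemma iter_sus (X : SymSpec.{u}) {q : ℕ} {m : SimplexCategoryᵒᵖ} (x : (X.lvl q).El m)
    (t : circle.{u}.El m) (p : ℕ) (u : Fin p → circle.{u}.El m) (h : q + (p + 1) = q + 1 + p) :
    X.iter (X.sus x t) p u = ev (X.along (finCongr h))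
      (X.iter x (p + 1) (Fin.cons (α := fun _ => circle.El m) t u)) := by
  induction p with
  | zero =>
    have h1 : X.along (finCongr h) = X.act (q + 1) 1 := X.along_perm 1
    rw [h1]
    exact (X.perm_one (X.sus x t)).symm
  | succ p ih =>
    change X.sus (X.iter (X.sus x t) p _) _ = _
    rw [ih _ (by omega), along_finCongr_sus]
    refine congrArg (ev (X.along (finCongr h))) ?_
    change _ = X.sus (X.iter x (p + 1) _) _
    congr 2
    funext i
    induction i using Fin.cases <;> simp

/-- The iterated structure map `X_q ∧ S^p → X_{q+p}`, as a function of a simplex of `S^p`. -/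
def iterSphere (X : SymSpec.{u}) {q : ℕ} {m : SimplexCategoryᵒᵖ} (x : (X.lvl q).El m) (p : ℕ)
    (s : (sphere.{u} p).El m) : (X.lvl (q + p)).El m :=
  sphere.lift (X.iter x p) ((X.lvl (q + p)).pt m) (X.iter_pt_right x p) s

/-- The bijection `q + p ≅ p + q ≅ n` determined by a labelling. -/
def swapLabel {p q n : ℕ} (e : Fin p ⊕ Fin q ≃ Fin n) : Fin (q + p) ≃ Fin n :=
  finSumFinEquiv.symm.trans ((Equiv.sumComm _ _).trans e)

/-- The left action of a representative: `[e, s ∧ x] ↦ e (s x)`. -/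
def actGen (X : SymSpec.{u}) {n : ℕ} {m : SimplexCategoryᵒᵖ} (g : SmashGen sphereSpec X n m) :
    (X.lvl n).El m :=
  ev (X.along (swapLabel g.e)) (X.iterSphere g.y g.p g.x)

lemma iterSphere_mk (X : SymSpec.{u}) {q : ℕ} {m : SimplexCategoryᵒᵖ} (x : (X.lvl q).El m) (p : ℕ)
    (t : Fin p → circle.{u}.El m) : X.iterSphere x p (sphere.mk t) = X.iter x p t := rfl

lemma actGen_perm (X : SymSpec.{u}) {n : ℕ} {m : SimplexCategoryᵒᵖ} (p q : ℕ)
    (e : Fin p ⊕ Fin q ≃ Fin n) (α : Equiv.Perm (Fin p)) (β : Equiv.Perm (Fin q))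
    (s : (sphere p).El m) (x : (X.lvl q).El m) :
    X.actGen ⟨p, q, (Equiv.sumCongr α β).trans e, s, x⟩ =
      X.actGen ⟨p, q, e, sphereSpec.perm α s, X.perm β x⟩ := by
  induction s using sphere.ind with
  | h0 => exact (ev_pt _ _).trans (ev_pt _ _).symm
  | h1 t =>
    have h : X.iter (X.perm β x) p (fun i => t (α⁻¹ i)) =
        ev (X.along (blockPerm β α)) (X.iter x p t) := by
      rw [along_perm]
      exact X.equivariant q p β α m x t
    change ev (X.along _) (X.iter x p t) =
      ev (X.along (swapLabel e)) (X.iter (X.perm β x) p (fun i => t (α⁻¹ i)))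
    rw [h, along_trans]
    congr 2
    ext i
    induction i using Fin.addCases <;> simp [swapLabel, blockPerm, Equiv.permCongr_apply]

lemma actGen_balance (X : SymSpec.{u}) {n : ℕ} {m : SimplexCategoryᵒᵖ} (p q : ℕ)
    (e : Fin (p + 1) ⊕ Fin q ≃ Fin n) (s : (sphere p).El m) (t : circle.{u}.El m)
    (x : (X.lvl q).El m) :
    X.actGen ⟨p + 1, q, e, sphereSpec.sus s t, x⟩ =
      X.actGen ⟨p, q + 1, (moveLast p q).trans e, s, X.sus x t⟩ := by
  induction s using sphere.ind with
  | h0 => exact (ev_pt _ _).trans (ev_pt _ _).symm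
  | h1 u =>
    have h0 : (Fin.cons (α := fun _ => circle.El m) t u) = fun i =>
        Fin.snoc (α := fun _ => circle.El m) u t ((finRotate (p + 1))⁻¹ i) := by
      funext i
      induction i using Fin.cases with
      | zero =>
        have : (finRotate (p + 1))⁻¹ 0 = Fin.last p := by
          rw [Equiv.Perm.inv_eq_iff_eq]; simp
        simp [this]
      | succ i =>
        have : (finRotate (p + 1))⁻¹ i.succ = i.castSucc := by
          rw [Equiv.Perm.inv_eq_iff_eq]; simp
        simp [this]
    have h1 : X.iter x (p + 1) (Fin.cons (α := fun _ => circle.El m) t u) =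
        ev (X.along (blockPerm 1 (finRotate (p + 1))))
          (X.iter x (p + 1) (Fin.snoc (α := fun _ => circle.El m) u t)) := by
      rw [h0, along_perm]
      exact (congrArg (fun y => X.iter y (p + 1) _) (X.perm_one x).symm).trans
        (X.equivariant q (p + 1) 1 (finRotate (p + 1)) m x
          (Fin.snoc (α := fun _ => circle.El m) u t))
    change ev (X.along (swapLabel e))
        (X.iter x (p + 1) (Fin.snoc (α := fun _ => circle.El m) u t)) =
      ev (X.along (swapLabel ((moveLast p q).trans e))) (X.iter (X.sus x t) p u)
    rw [iter_sus X x t p u (by omega), h1, along_trans, along_trans]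
    congr 2
    ext i
    induction i using Fin.addCases (m := q) (n := p + 1) with
    | left i =>
      have h : finCongr (by omega : q + (p + 1) = q + 1 + p) (Fin.castAdd (p + 1) i) =
        Fin.castAdd p i.castSucc := by ext; simp
      have h' : blockPerm (1 : Equiv.Perm (Fin q)) (finRotate (p + 1)) (Fin.castAdd (p + 1) i) =
        Fin.castAdd (p + 1) i := by simp [blockPerm, Equiv.permCongr_apply]
      simp only [Equiv.trans_apply, h', h]
      simp [swapLabel, moveLast]
    | right j =>
      induction j using Fin.lastCases with
      | last =>
        have h : finCongr (by omega : q + (p + 1) = q + 1 + p) (Fin.natAdd q 0) =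
          Fin.castAdd p (Fin.last q) := by ext; simp
        have h' : blockPerm (1 : Equiv.Perm (Fin q)) (finRotate (p + 1))
            (Fin.natAdd q (Fin.last p)) = Fin.natAdd q 0 := by
          simp [blockPerm, Equiv.permCongr_apply, -Fin.natAdd_last]
        simp only [Equiv.trans_apply, h', h]
        simp [swapLabel, moveLast, -Fin.natAdd_last]
      | cast j =>
        have h : finCongr (by omega : q + (p + 1) = q + 1 + p) (Fin.natAdd q j.succ) =
          Fin.natAdd (q + 1) j := by ext; simp; omega
        have h' : blockPerm (1 : Equiv.Perm (Fin q)) (finRotate (p + 1))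
            (Fin.natAdd q j.castSucc) = Fin.natAdd q j.succ := by
          simp [blockPerm, Equiv.permCongr_apply]
        simp only [Equiv.trans_apply, h', h]
        simp [swapLabel, moveLast]

/-- The action map `(S ∧ X)_n → X_n`, `[e, s ∧ x] ↦ e (s x)`, of a symmetric spectrum. -/
def action (X : SymSpec.{u}) (n : ℕ) : smashLvl sphereSpec X n ⟶ X.lvl n :=
  homMk (fun m => Quot.lift (fun o => o.elim ((X.lvl n).pt m) X.actGen) (by
      rintro _ _ (⟨p, q, e, y⟩ | ⟨p, q, e, x⟩ | ⟨p, q, e, α, β, x, y⟩ | ⟨p, q, e, x, t, y⟩)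
      · exact ev_pt _ _
      · refine (congrArg (ev (X.along (swapLabel e))) ?_).trans (ev_pt (X.along (swapLabel e)) m)
        change X.iterSphere _ p x = _
        induction x using sphere.ind with
        | h0 => rfl
        | h1 t => exact X.iter_pt_left p t
      · exact X.actGen_perm p q e α β x y
      · exact X.actGen_balance p q e x t y))
    (fun _ => rfl)
    (fun {m m'} θ z => by
      induction z using smashLvl.ind with
      | h0 => exact ((X.lvl n).res_pt θ).symm
      | h1 g =>
        obtain ⟨p, q, e, s, x⟩ := g
        refine Eq.trans (congrArg (ev (X.along (swapLabel e))) ?_)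
          (ev_res (X.along (swapLabel e)) θ (X.iterSphere x p s))
        change X.iterSphere ((X.lvl q).res θ x) p ((sphere p).res θ s) = _
        induction s using sphere.ind with
        | h0 => exact ((X.lvl (q + p)).res_pt θ).symm
        | h1 t => exact X.iter_res θ x p t)

lemma action_naturality {X Y : SymSpec.{u}} (f : X ⟶ Y) (n : ℕ) :
    smashLvl.map (𝟙 sphereSpec) f n ≫ Y.action n = X.action n ≫ Hom.app f n := by
  refine PSSet.hom_ext fun m z => ?_
  induction z using smashLvl.ind with
  | h0 => exact (ev_pt (Hom.app f n) m).symm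
  | h1 g =>
    obtain ⟨p, q, e, s, x⟩ := g
    change ev (Y.along (swapLabel e)) (Y.iterSphere (ev (Hom.app f q) x) p s) =
      ev (Hom.app f n) (ev (X.along (swapLabel e)) (X.iterSphere x p s))
    rw [along_naturality]
    refine congrArg (ev (Y.along (swapLabel e))) ?_
    induction s using sphere.ind with
    | h0 => exact (ev_pt (Hom.app f (q + p)) m).symm
    | h1 t => exact (app_iter f x p t).symm

/-! ### Latching objects of symmetric spectra and flat cofibrations -/

/-- The latching object `L_n X = (S̄ ∧ X)_n` of a symmetric spectrum, as a functor of `X`. -/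
def latch (n : ℕ) : SymSpec.{u} ⥤ PSSet.{u} where
  obj X := smashLvl sphereBar X n
  map f := smashLvl.map (𝟙 sphereBar) f n
  map_id X := PSSet.hom_ext fun m z => by
    induction z using smashLvl.ind <;> rfl
  map_comp f g := PSSet.hom_ext fun m z => by
    induction z using smashLvl.ind <;> rfl

/-- The natural map `ν_n : L_n X = (S̄ ∧ X)_n → (S ∧ X)_n ≅ X_n`, induced by `S̄ → S`. -/
def nu (n : ℕ) : latch.{u} n ⟶ level n where
  app X := smashLvl.map sphereBarι (𝟙 X) n ≫ X.action n
  naturality X Y f := by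
    have h : smashLvl.map (𝟙 sphereBar) f n ≫ smashLvl.map sphereBarι (𝟙 Y) n =
        smashLvl.map sphereBarι (𝟙 X) n ≫ smashLvl.map (𝟙 sphereSpec) f n :=
      PSSet.hom_ext fun m z => by
        induction z using smashLvl.ind <;> rfl
    change smashLvl.map (𝟙 sphereBar) f n ≫ smashLvl.map sphereBarι (𝟙 Y) n ≫
      Y.action n = (smashLvl.map sphereBarι (𝟙 X) n ≫ X.action n) ≫ Hom.app f n
    rw [← Category.assoc, h, Category.assoc, action_naturality, Category.assoc]

/-- A levelwise cofibration of symmetric spectra. -/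
def IsLevelwiseCofibration {X Y : SymSpec.{u}} (f : X ⟶ Y) : Prop :=
  ∀ n : ℕ, IsCofibration ((level n).map f)

/-- The pushout corner map `X_n ⨿_{L_n X} L_n Y → Y_n` of a map `f : X → Y`. -/
noncomputable def cornerMap {X Y : SymSpec.{u}} (f : X ⟶ Y) (n : ℕ) :
    pushout ((nu n).app X) ((latch n).map f) ⟶ (level n).obj Y :=
  pushout.desc ((level n).map f) ((nu n).app Y) ((nu n).naturality f).symm

/-- A flat cofibration of symmetric spectra. -/
def IsFlatCofibration {X Y : SymSpec.{u}} (f : X ⟶ Y) : Prop :=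
  ∀ n : ℕ, IsCofibration (cornerMap f n)

/-- A positive flat cofibration of symmetric spectra. -/
def IsPositiveFlatCofibration {X Y : SymSpec.{u}} (f : X ⟶ Y) : Prop :=
  IsFlatCofibration f ∧ IsIso ((level 0).map f)

/-- A symmetric spectrum is flat-cofibrant if the map from the zero object is a flat
cofibration. -/
def IsFlatCofibrant (X : SymSpec.{u}) : Prop :=
  IsFlatCofibration ((isZero_zero SymSpec.{u}).to_ X)

/-- A symmetric spectrum is positive flat-cofibrant if the map from the zero object is a positive
flat cofibration. -/
def IsPositiveFlatCofibrant (X : SymSpec.{u}) : Prop :=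
  IsPositiveFlatCofibration ((isZero_zero SymSpec.{u}).to_ X)

end SymSpec

/-! ### Latching objects of simplicial objects -/

section SimplicialLatching

open scoped ZeroObject

variable {C : Type*} [Category* C] [HasFiniteCoproducts C]

/-- The index set of pairs `i < j` of elements of `{0, ..., n - 1}`. -/
abbrev DegPair (n : ℕ) : Type := {p : Fin n × Fin n // p.1 < p.2}

open Simplicial in
/-- The map `∐_{i < j} X_n → ∐_k X_{n+1}` which on the summand `(i, j)` is `s_i` followed by the
inclusion of the summand `j`. -/
noncomputable def latchLeft (X : SimplicialObject C) (n : ℕ) :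
    (∐ fun _ : DegPair (n + 2) => X _⦋n⦌) ⟶ ∐ fun _ : Fin (n + 2) => X _⦋n + 1⦌ :=
  Sigma.desc fun p => X.σ (⟨p.1.1, by have := p.2; omega⟩ : Fin (n + 1)) ≫
    Sigma.ι (fun _ : Fin (n + 2) => X _⦋n + 1⦌) p.1.2

open Simplicial in
/-- The map `∐_{i < j} X_n → ∐_k X_{n+1}` which on the summand `(i, j)` is `s_{j-1}` followed by
the inclusion of the summand `i`. -/
noncomputable def latchRight (X : SimplicialObject C) (n : ℕ) :
    (∐ fun _ : DegPair (n + 2) => X _⦋n⦌) ⟶ ∐ fun _ : Fin (n + 2) => X _⦋n + 1⦌ :=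
  Sigma.desc fun p => X.σ (⟨p.1.2 - 1, by have := p.2; omega⟩ : Fin (n + 1)) ≫
    Sigma.ι (fun _ : Fin (n + 2) => X _⦋n + 1⦌) p.1.1

open Simplicial in
/-- The map `∐_k X_{n+1} → X_{n+2}` given by the degeneracies. -/
noncomputable def degeneracies (X : SimplicialObject C) (n : ℕ) :
    (∐ fun _ : Fin (n + 2) => X _⦋n + 1⦌) ⟶ X _⦋n + 2⦌ :=
  Sigma.desc fun k => X.σ k

lemma latch_condition (X : SimplicialObject C) (n : ℕ) :
    latchLeft X n ≫ degeneracies X n = latchRight X n ≫ degeneracies X n := by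
  refine Sigma.hom_ext _ _ fun ⟨⟨i, j⟩, hij⟩ => ?_
  simp only [latchLeft, latchRight, degeneracies, Sigma.ι_desc, Sigma.ι_desc_assoc,
    Category.assoc]
  obtain ⟨i, hi⟩ := i
  obtain ⟨j, hj⟩ := j
  obtain ⟨j, rfl⟩ : ∃ k, j = k + 1 := ⟨j - 1, by simp at hij; omega⟩
  simp only [Fin.mk_lt_mk] at hij
  exact (X.σ_comp_σ (i := ⟨i, by omega⟩) (j := ⟨j, by omega⟩) (by simp; omega)).symm

variable [HasZeroObject C] [HasCoequalizers C]

/-- The latching object of a simplicial object in degree `n`: the zero object if `n = 0`, the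
object `X_0` if `n = 1`, and the coequalizer of the maps `latchLeft` and `latchRight` if
`n ≥ 2`. -/
noncomputable def latchingObj (X : SimplicialObject C) : ℕ → C
  | 0 => 0
  | 1 => X.obj (op (.mk 0))
  | n + 2 => coequalizer (latchLeft X n) (latchRight X n)

/-- The latching map of a simplicial object in degree `n`, induced by the degeneracies. -/
noncomputable def latchingMap (X : SimplicialObject C) : ∀ n : ℕ, (latchingObj X n ⟶ X.obj (op (.mk n)))
  | 0 => (isZero_zero C).to_ _
  | 1 => X.σ (0 : Fin 1)
  | n + 2 => coequalizer.desc (degeneracies X n) (latch_condition X n)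

end SimplicialLatching

/-! ### Good simplicial symmetric spectra -/

section Good

/-- A simplicial symmetric spectrum is good if each `X_n` is flat-cofibrant and the degeneracy
maps are levelwise cofibrations. -/
structure IsGood (X : SimplicialObject SymSpec.{u}) : Prop where
  flatCofibrant : ∀ n : ℕ, SymSpec.IsFlatCofibrant (X.obj (op (.mk n)))
  degeneracy : ∀ (n : ℕ) (i : Fin (n + 1)), SymSpec.IsLevelwiseCofibration (X.σ i)

/-- A simplicial symmetric spectrum is positive-good if it is good and each `X_n` is positive
flat-cofibrant. -/
structure IsPositiveGood (X : SimplicialObject SymSpec.{u}) : Prop extends IsGood X where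
  positiveFlatCofibrant : ∀ n : ℕ, SymSpec.IsPositiveFlatCofibrant (X.obj (op (.mk n)))

/-- A simplicial symmetric spectrum is Reedy flat-cofibrant if all its latching maps are flat
cofibrations. -/
def IsReedyFlatCofibrant (X : SimplicialObject SymSpec.{u}) : Prop :=
  ∀ n : ℕ, SymSpec.IsFlatCofibration (latchingMap X n)

/-- A simplicial symmetric spectrum is Reedy positive flat-cofibrant if all its latching maps are
positive flat cofibrations. -/
def IsReedyPositiveFlatCofibrant (X : SimplicialObject SymSpec.{u}) : Prop :=
  ∀ n : ℕ, SymSpec.IsPositiveFlatCofibration (latchingMap X n)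

end Good

end SymmetricSpectra

/-!
The degeneracies of a simplicial object are split by its face maps, and this makes the theorem a
statement about simplicial sets. Fix a spectrum level `k` and a simplicial degree `m`. The
simplices `(X_n)(k)_m` form a simplicial set `A` in the variable `n`, and the simplices
`(L_k X_n)_m` form a simplicial set `B`; since each `X_n` is flat-cofibrant, `ν` embeds `B` in `A`
(`nu_injective`). The latching object of `X` in degree `n` has the degenerate `n`-simplices of `A`
as its simplices: the coprojections onto it are jointly surjective (`exists_coprojection`), and
two representatives `s_i x = s_j y` of the same degenerate simplex are identified already in the
coequalizer, because `x = s_{j-1} w` and `y = s_i w` for `w = d_i y` when `i < j`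
(`latchingMap_injective`).

The corner map is therefore injective as soon as every degenerate simplex `s_i a` of `A` which
lies in `B` is a degenerate simplex of `B`, and so it is: `a = d_i s_i a` lies in `B`
(`isFlatCofibration_of_split`). Thus the latching objects `L_k` never have to be compared
with colimits. In the positive case level `0`
of every `X_n` is a point, hence so is level `0` of the latching objects.
-/

open CategoryTheory Limits Opposite

namespace SymmetricSpectra

/-! ### Pushouts and isomorphisms of pointed simplicial sets -/

namespace PSSet

/-- The pointed simplicial subset of `A` on the simplices satisfying `P`. -/
def sub (A : PSSet.{u}) (P : ∀ m, A.El m → Prop) (hpt : ∀ m, P m (A.pt m))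
    (hres : ∀ {m m' : SimplexCategoryᵒᵖ} (θ : m ⟶ m') (x : A.El m), P m x → P m' (A.res θ x)) :
    PSSet.{u} :=
  mk' (fun m => {x : A.El m // P m x}) (fun m => ⟨A.pt m, hpt m⟩)
    (fun θ x => ⟨A.res θ x.1, hres θ x.1 x.2⟩)
    (fun θ => Subtype.ext (A.res_pt θ))
    (fun _ x => Subtype.ext (A.res_id _ x.1))
    (fun θ η x => Subtype.ext (A.res_comp θ η x.1))

/-- The constant map at the basepoint. -/
def const (A B : PSSet.{u}) : A ⟶ B :=
  homMk (fun m _ => B.pt m) (fun _ => rfl) (fun θ _ => (B.res_pt θ).symm)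

lemma ev_congr {A B : PSSet.{u}} {f g : A ⟶ B} (h : f = g) {m : SimplexCategoryᵒᵖ}
    (x : A.El m) : ev f x = ev g x := by rw [h]

/-- The pushout is the union of the images of its coprojections: both factor through the
pointed simplicial subset on that union. -/
lemma pushout_cases {A B C : PSSet.{u}} (f : A ⟶ B) (g : A ⟶ C) {m : SimplexCategoryᵒᵖ}
    (z : (pushout f g).El m) :
    (∃ b, ev (pushout.inl f g) b = z) ∨ ∃ c, ev (pushout.inr f g) c = z := by
  let P : ∀ m, (pushout f g).El m → Prop := fun m z =>
    (∃ b, ev (pushout.inl f g) b = z) ∨ ∃ c, ev (pushout.inr f g) c = z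
  let S : PSSet.{u} := sub (pushout f g) P (fun m => Or.inl ⟨_, ev_pt _ m⟩) (by
    rintro m m' θ _ (⟨b, rfl⟩ | ⟨c, rfl⟩)
    · exact Or.inl ⟨_, ev_res _ θ b⟩
    · exact Or.inr ⟨_, ev_res _ θ c⟩)
  let i : S ⟶ pushout f g := homMk (fun _ x => x.1) (fun _ => rfl) (fun _ _ => rfl)
  let l : B ⟶ S := homMk (fun _ b => ⟨ev (pushout.inl f g) b, Or.inl ⟨b, rfl⟩⟩)
    (fun m => Subtype.ext (ev_pt _ m)) (fun θ b => Subtype.ext (ev_res _ θ b))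
  let r : C ⟶ S := homMk (fun _ c => ⟨ev (pushout.inr f g) c, Or.inr ⟨c, rfl⟩⟩)
    (fun m => Subtype.ext (ev_pt _ m)) (fun θ c => Subtype.ext (ev_res _ θ c))
  have hlr : f ≫ l = g ≫ r := PSSet.hom_ext fun m a =>
    Subtype.ext (ev_congr (pushout.condition (f := f) (g := g)) a)
  have h : pushout.desc l r hlr ≫ i = 𝟙 (pushout f g) := by
    apply pushout.hom_ext
    · rw [pushout.inl_desc_assoc, Category.comp_id]; rfl
    · rw [pushout.inr_desc_assoc, Category.comp_id]; rfl
  rw [← ev_id z, ← h]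
  exact (ev (pushout.desc l r hlr) z).2

lemma isIso_of_subsingleton {A B : PSSet.{u}} (f : A ⟶ B)
    (hA : ∀ m (x : A.El m), x = A.pt m) (hB : ∀ m (x : B.El m), x = B.pt m) : IsIso f :=
  ⟨const B A, PSSet.hom_ext fun m x => (hA m x).symm, PSSet.hom_ext fun m x =>
    (ev_pt f m).trans (hB m x).symm⟩

end PSSet

open PSSet

namespace SymSpec

/-! ### Subspectra -/

/-- The simplices of `X` satisfying `P` form a subspectrum: they contain the basepoints and are
closed under simplicial operators, permutations and structure maps. -/
structure IsSubspectrum (X : SymSpec.{u})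
    (P : ∀ {n : ℕ} {m : SimplexCategoryᵒᵖ}, (X.lvl n).El m → Prop) : Prop where
  pt : ∀ n m, P ((X.lvl n).pt m)
  res : ∀ {n : ℕ} {m m' : SimplexCategoryᵒᵖ} (θ : m ⟶ m') (x : (X.lvl n).El m),
    P x → P ((X.lvl n).res θ x)
  perm : ∀ {n : ℕ} {m : SimplexCategoryᵒᵖ} (α : Equiv.Perm (Fin n)) (x : (X.lvl n).El m),
    P x → P (X.perm α x)
  sus : ∀ {n : ℕ} {m : SimplexCategoryᵒᵖ} (x : (X.lvl n).El m) (t : circle.{u}.El m),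
    P x → P (X.sus x t)

namespace IsSubspectrum

variable {X : SymSpec.{u}} {P : ∀ {n : ℕ} {m : SimplexCategoryᵒᵖ}, (X.lvl n).El m → Prop}

/-- The levels of a subspectrum. -/
def lvl (h : IsSubspectrum X P) (n : ℕ) : PSSet.{u} :=
  PSSet.sub (X.lvl n) (fun _ x => P x) (h.pt n) h.res

/-- The structure maps of a subspectrum. -/
def str (h : IsSubspectrum X P) (n : ℕ) : smash (h.lvl n) circle ⟶ h.lvl (n + 1) :=
  smash.desc (fun _ x t => ⟨X.sus x.1 t, h.sus x.1 t x.2⟩)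
    (fun _ t => Subtype.ext (X.sus_pt_left t)) (fun _ x => Subtype.ext (X.sus_pt_right x.1))
    (fun θ x t => Subtype.ext (X.sus_res θ x.1 t))

lemma str_iter (h : IsSubspectrum X P) {n : ℕ} {m : SimplexCategoryᵒᵖ} (x : (h.lvl n).El m)
    (k : ℕ) (t : Fin k → circle.{u}.El m) :
    Subtype.val (iterStr h.str x k t) = X.iter x.1 k t := by
  induction k with
  | zero => rfl
  | succ k ih => exact congrArg (fun y => X.sus y (t (Fin.last k))) (ih _)

/-- The subspectrum of `X` on the simplices satisfying `P`. -/
def spec (h : IsSubspectrum X P) : SymSpec.{u} where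
  lvl := h.lvl
  act n :=
    { toFun := fun α => homMk (fun _ x => ⟨X.perm α x.1, h.perm α x.1 x.2⟩)
        (fun _ => Subtype.ext (X.perm_pt α)) (fun θ x => Subtype.ext (X.perm_res α θ x.1))
      map_one' := PSSet.hom_ext fun m x => Subtype.ext (X.perm_one x.1)
      map_mul' := fun α β => PSSet.hom_ext fun m x => Subtype.ext (X.perm_mul α β x.1) }
  str := h.str
  equivariant n k α β m x t := Subtype.ext (by
    refine (h.str_iter _ k _).trans ((X.equivariant n k α β m x.1 t).trans ?_)
    exact congrArg (X.perm (blockPerm α β)) (h.str_iter x k t).symm)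

/-- The inclusion of a subspectrum. -/
def ι (h : IsSubspectrum X P) : h.spec ⟶ X where
  app _ := homMk (fun _ x => x.1) (fun _ => rfl) (fun _ _ => rfl)
  app_perm _ _ _ _ := rfl
  app_sus _ _ _ _ := rfl

/-- A map with image in a subspectrum, as a map to that subspectrum. -/
def lift (h : IsSubspectrum X P) {Y : SymSpec.{u}} (f : Y ⟶ X)
    (hf : ∀ n m (y : (Y.lvl n).El m), P (ev (Hom.app f n) y)) : Y ⟶ h.spec where
  app n := homMk (fun m y => ⟨ev (Hom.app f n) y, hf n m y⟩)
    (fun m => Subtype.ext (ev_pt _ m)) (fun θ y => Subtype.ext (ev_res _ θ y))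
  app_perm n α m y := Subtype.ext (Hom.app_perm f n α m y)
  app_sus n m y t := Subtype.ext (Hom.app_sus f n m y t)

lemma ι_injective (h : IsSubspectrum X P) {Y : SymSpec.{u}} {f g : Y ⟶ h.spec}
    (hfg : f ≫ h.ι = g ≫ h.ι) : f = g :=
  SymSpec.hom_ext fun n => PSSet.hom_ext fun _ y => Subtype.ext
    (congrArg (fun φ => ev (Hom.app φ n) y) hfg)

/-- A subspectrum whose inclusion has a section is everything. -/
lemma of_section (h : IsSubspectrum X P) (s : X ⟶ h.spec) (hs : s ≫ h.ι = 𝟙 X) {n : ℕ}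
    {m : SimplexCategoryᵒᵖ} (x : (X.lvl n).El m) : P x := by
  have hx : (ev (Hom.app s n) x).1 = x := congrArg (fun φ => ev (Hom.app φ n) x) hs
  rw [← hx]
  exact (ev (Hom.app s n) x).2

end IsSubspectrum

/-- The union of the images of a family of maps of spectra, with nonempty index set,
so that the union contains the basepoints. -/
lemma isSubspectrum_union {I : Type*} [Nonempty I] {Y : I → SymSpec.{u}} {X : SymSpec.{u}}
    (f : ∀ i, Y i ⟶ X) :
    IsSubspectrum X fun {n m} x => ∃ i, ∃ y : ((Y i).lvl n).El m, ev (Hom.app (f i) n) y = x where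
  pt n m := ⟨Classical.arbitrary I, _, ev_pt _ m⟩
  res := by
    rintro n m m' θ _ ⟨i, y, rfl⟩
    exact ⟨i, _, ev_res _ θ y⟩
  perm := by
    rintro n m α _ ⟨i, y, rfl⟩
    exact ⟨i, _, Hom.app_perm (f i) n α m y⟩
  sus := by
    rintro n m _ t ⟨i, y, rfl⟩
    exact ⟨i, _, Hom.app_sus (f i) n m y t⟩

/-! ### Criteria for flat cofibrations -/

lemma eq_pt_of_isZero {X : SymSpec.{u}} (hX : IsZero X) {n : ℕ} {m : SimplexCategoryᵒᵖ}
    (x : (X.lvl n).El m) : x = (X.lvl n).pt m := by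
  have h : 𝟙 X = hX.to_ trivial ≫ hX.from_ trivial := hX.eq_of_src _ _
  have hx : x = ev (Hom.app (hX.from_ trivial) n) (ev (Hom.app (hX.to_ trivial) n) x) :=
    congrArg (fun φ => ev (Hom.app φ n) x) h
  rw [hx]
  exact ev_pt (Hom.app (hX.from_ trivial) n) m

lemma latch_eq_pt_of_isZero {X : SymSpec.{u}} (hX : IsZero X) {k : ℕ} {m : SimplexCategoryᵒᵖ}
    (z : ((latch k).obj X).El m) : z = ((latch k).obj X).pt m := by
  induction z using smashLvl.ind with
  | h0 => rfl
  | h1 g =>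
    obtain ⟨p, q, e, s, x⟩ := g
    obtain rfl := eq_pt_of_isZero hX x
    exact Quot.sound (.pt_right p q e s)

open scoped ZeroObject in
/-- For `X = 0` the corner map is `ν_k`, up to the identification of the pushout with
`L_k Y`. -/
lemma nu_injective {Y : SymSpec.{u}} (hY : IsFlatCofibrant Y) (k : ℕ) :
    IsCofibration ((nu k).app Y) := by
  intro m b b' h
  let f := (isZero_zero SymSpec.{u}).to_ Y
  let ρ : pushout ((nu k).app 0) ((latch k).map f) ⟶ (latch k).obj Y :=
    pushout.desc (const _ _) (𝟙 _) (PSSet.hom_ext fun m z => by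
      obtain rfl := latch_eq_pt_of_isZero (isZero_zero _) z
      rw [ev_pt, ev_pt])
  have hρ : ∀ b, ev ρ (ev (pushout.inr ((nu k).app 0) ((latch k).map f)) b) =
      (b : ((latch k).obj Y).El m) :=
    fun b => ev_congr (pushout.inr_desc (f := (nu k).app 0) (g := (latch k).map f) _ _ _) b
  have hc : ∀ b, ev (cornerMap f k) (ev (pushout.inr ((nu k).app 0) ((latch k).map f)) b) =
      ev ((nu k).app Y) (b : ((latch k).obj Y).El m) :=
    fun b => ev_congr (pushout.inr_desc (f := (nu k).app 0) (g := (latch k).map f) _ _ _) b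
  rw [← hρ b, ← hρ b', hY k m ((hc b).trans (h.trans (hc b').symm))]

lemma cornerMap_injective {X Y : SymSpec.{u}} (f : X ⟶ Y) (k : ℕ)
    (hf : IsCofibration ((level k).map f)) (hY : IsCofibration ((nu k).app Y))
    (hfY : ∀ m (a : ((level k).obj X).El m) (b : ((latch k).obj Y).El m),
      ev ((level k).map f) a = ev ((nu k).app Y) b →
        ∃ c, ev ((nu k).app X) c = a ∧ ev ((latch k).map f) c = b) :
    IsCofibration (cornerMap f k) := by
  intro m z z' h
  have hl : ∀ a, ev (cornerMap f k) (ev (pushout.inl ((nu k).app X) ((latch k).map f)) a) =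
      ev ((level k).map f) (a : ((level k).obj X).El m) :=
    fun a => ev_congr (pushout.inl_desc (f := (nu k).app X) (g := (latch k).map f) _ _ _) a
  have hr : ∀ b, ev (cornerMap f k) (ev (pushout.inr ((nu k).app X) ((latch k).map f)) b) =
      ev ((nu k).app Y) (b : ((latch k).obj Y).El m) :=
    fun b => ev_congr (pushout.inr_desc (f := (nu k).app X) (g := (latch k).map f) _ _ _) b
  have hlr : ∀ a b, ev ((level k).map f) (a : ((level k).obj X).El m) = ev ((nu k).app Y) b →
      ev (pushout.inl ((nu k).app X) ((latch k).map f)) a =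
        ev (pushout.inr ((nu k).app X) ((latch k).map f)) b := by
    intro a b hab
    obtain ⟨c, rfl, rfl⟩ := hfY m a b hab
    exact ev_congr pushout.condition c
  obtain ⟨a, rfl⟩ | ⟨b, rfl⟩ := pushout_cases _ _ z <;>
    obtain ⟨a', rfl⟩ | ⟨b', rfl⟩ := pushout_cases _ _ z'
  · rw [hl, hl] at h
    rw [hf m h]
  · rw [hl, hr] at h
    exact hlr a b' h
  · rw [hr, hl] at h
    exact (hlr a' b h.symm).symm
  · rw [hr, hr] at h
    rw [hY m h]

/-- A levelwise cofibration `f : L → Y` to a flat-cofibrant spectrum is a flat cofibration if `L`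
is the union of the images of maps `g i : Z → L` such that each `g i ≫ f` has a retraction `r i`.
If `f (g i a')` lies in the latching object of `Y`, then the retraction shows that `a'` lies in
that of `Z`, so that `g i a'` lies in that of `L`. -/
lemma isFlatCofibration_of_split {I : Type*} {Z L Y : SymSpec.{u}} (hY : IsFlatCofibrant Y)
    (f : L ⟶ Y) (hf : IsLevelwiseCofibration f) (g : I → (Z ⟶ L)) (r : I → (Y ⟶ Z))
    (hr : ∀ i, g i ≫ f ≫ r i = 𝟙 Z)
    (hg : ∀ (k : ℕ) (m : SimplexCategoryᵒᵖ) (a : (L.lvl k).El m),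
      ∃ i, ∃ a' : (Z.lvl k).El m, ev (Hom.app (g i) k) a' = a) : IsFlatCofibration f := by
  intro k
  refine cornerMap_injective f k (hf k) (nu_injective hY k) fun m a b hab => ?_
  obtain ⟨i, a', rfl⟩ := hg k m a
  have nat : ∀ {V W : SymSpec.{u}} (φ : V ⟶ W) (z : ((latch k).obj V).El m),
      ev ((nu k).app W) (ev ((latch k).map φ) z) = ev (Hom.app φ k) (ev ((nu k).app V) z) :=
    fun φ z => ev_congr ((nu k).naturality φ) z
  have ha' : ev (Hom.app (r i) k) (ev (Hom.app f k) (ev (Hom.app (g i) k) a')) = a' :=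
    congrArg (fun φ => ev (Hom.app φ k) a') (hr i)
  have hc : ev ((nu k).app L) (ev ((latch k).map (g i)) (ev ((latch k).map (r i)) b)) =
      ev (Hom.app (g i) k) a' := by
    rw [nat, nat, ← hab]
    exact congrArg _ ha'
  refine ⟨ev ((latch k).map (g i)) (ev ((latch k).map (r i)) b), hc, nu_injective hY k m ?_⟩
  rw [nat, hc]
  exact hab

end SymSpec

open SymSpec

/-! ### Latching objects of simplicial spectra -/

/-- The coprojections onto the latching object of a simplicial spectrum in positive degree. -/
noncomputable def coprojection (X : SimplicialObject SymSpec.{u}) :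
    ∀ n : ℕ, Fin (n + 1) → (X.obj (op (.mk n)) ⟶ latchingObj X (n + 1))
  | 0, _ => 𝟙 _
  | n + 1, i => Sigma.ι (fun _ : Fin (n + 2) => X.obj (op (.mk (n + 1)))) i ≫
      coequalizer.π (latchLeft X n) (latchRight X n)

lemma coprojection_latchingMap (X : SimplicialObject SymSpec.{u}) (n : ℕ) (i : Fin (n + 1)) :
    coprojection X n i ≫ latchingMap X (n + 1) = X.σ i := by
  cases n with
  | zero =>
    obtain rfl := Fin.fin_one_eq_zero i
    exact Category.id_comp _
  | succ n =>
    change (Sigma.ι (fun _ : Fin (n + 2) => X.obj (op (.mk (n + 1)))) i ≫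
      coequalizer.π (latchLeft X n) (latchRight X n)) ≫
        coequalizer.desc (degeneracies X n) (latch_condition X n) = X.σ i
    rw [Category.assoc, coequalizer.π_desc, degeneracies, Sigma.ι_desc]

open Simplicial in
lemma exists_coprojection (X : SimplicialObject SymSpec.{u}) (n k : ℕ) (m : SimplexCategoryᵒᵖ)
    (a : ((latchingObj X (n + 1)).lvl k).El m) :
    ∃ i, ∃ x : ((X _⦋n⦌).lvl k).El m, ev (Hom.app (coprojection X n i) k) x = a := by
  cases n with
  | zero => exact ⟨0, a, rfl⟩
  | succ n =>
    -- All coprojections factor through the union of their images.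
    have h := isSubspectrum_union (coprojection X (n + 1))
    let l : ∀ i, X _⦋n + 1⦌ ⟶ h.spec := fun i =>
      h.lift (coprojection X (n + 1) i) fun _ _ y => ⟨i, y, rfl⟩
    have hl : Sigma.desc l ≫ h.ι = coequalizer.π (latchLeft X n) (latchRight X n) :=
      Sigma.hom_ext _ _ fun i => by rw [Sigma.ι_desc_assoc]; rfl
    have hd : latchLeft X n ≫ Sigma.desc l = latchRight X n ≫ Sigma.desc l :=
      h.ι_injective (by
        rw [Category.assoc, Category.assoc, hl]
        exact coequalizer.condition _ _)
    refine h.of_section (coequalizer.desc (Sigma.desc l) hd) (coequalizer.hom_ext ?_) a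
    exact (coequalizer.π_desc_assoc _ hd _).trans (hl.trans (Category.comp_id _).symm)

open Simplicial in
lemma coprojection_comp (X : SimplicialObject SymSpec.{u}) (n : ℕ) (i : Fin (n + 1))
    (j : Fin (n + 1)) (hij : i ≤ j) :
    X.σ i ≫ coprojection X (n + 1) j.succ = X.σ j ≫ coprojection X (n + 1) i.castSucc := by
  have h := Sigma.ι (fun _ : DegPair (n + 2) => X _⦋n⦌)
    ⟨(i.castSucc, j.succ), Fin.castSucc_lt_succ_iff.2 hij⟩ ≫=
      coequalizer.condition (latchLeft X n) (latchRight X n)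
  simp only [latchLeft, latchRight, Sigma.ι_desc_assoc, Category.assoc] at h
  exact h

open Simplicial in
lemma latchingMap_injective (X : SimplicialObject SymSpec.{u}) (n : ℕ) :
    IsLevelwiseCofibration (latchingMap X (n + 1)) := by
  intro k m a a' h
  obtain ⟨i, x, rfl⟩ := exists_coprojection X n k m a
  obtain ⟨j, y, rfl⟩ := exists_coprojection X n k m a'
  have hσ : ∀ i (x : ((X _⦋n⦌).lvl k).El m),
      ev (Hom.app (latchingMap X (n + 1)) k) (ev (Hom.app (coprojection X n i) k) x) =
        ev (Hom.app (X.σ i) k) x := fun i x =>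
    congrArg (fun φ => ev (Hom.app φ k) x) (coprojection_latchingMap X n i)
  have h' : ev (Hom.app (X.σ i) k) x = ev (Hom.app (X.σ j) k) y :=
    (hσ i x).symm.trans (h.trans (hσ j y))
  clear h
  have hδ : ∀ i (x : ((X _⦋n⦌).lvl k).El m),
      ev (Hom.app (X.δ i.castSucc) k) (ev (Hom.app (X.σ i) k) x) = x := fun i x =>
    congrArg (fun φ => ev (Hom.app φ k) x) (X.δ_comp_σ_self (i := i))
  wlog hij : i ≤ j generalizing i j x y
  · exact (this j y i x h'.symm (le_of_not_ge hij)).symm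
  obtain rfl | hij := hij.eq_or_lt
  · rw [← hδ i x, h', hδ]
  -- From here on `i < j`, so that `j = j' + 1` with `i ≤ j'`.
  cases n with
  | zero => omega
  | succ n =>
    obtain ⟨j, rfl⟩ := Fin.exists_succ_eq.2 (Fin.ne_zero_of_lt hij)
    obtain ⟨i, rfl⟩ := Fin.exists_castSucc_eq.2 (Fin.ne_last_of_lt hij)
    have hij' : i ≤ j := Fin.castSucc_lt_succ_iff.1 hij
    let w := ev (Hom.app (X.δ i.castSucc) k) y
    have hx : x = ev (Hom.app (X.σ j) k) w := by
      rw [← hδ i.castSucc x, h']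
      exact congrArg (fun φ => ev (Hom.app φ k) y)
        (X.δ_comp_σ_of_le (i := i.castSucc) (j := j) (Fin.castSucc_le_castSucc_iff.2 hij'))
    have hy : y = ev (Hom.app (X.σ i) k) w := by
      rw [← hδ j.succ y, ← h', hx,
        ← hδ j.succ (ev (Hom.app (X.σ i) k) w)]
      exact congrArg (fun φ => ev (Hom.app φ k) w)
        (congrArg (· ≫ X.δ j.succ.castSucc) (X.σ_comp_σ hij'))
    rw [hx, hy]
    exact congrArg (fun φ => ev (Hom.app φ k) w) (coprojection_comp X n i j hij').symm

/-! ### Reedy cofibrancy of good simplicial spectra -/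

lemma eq_pt_of_isPositiveFlatCofibrant {Y : SymSpec.{u}} (hY : IsPositiveFlatCofibrant Y)
    {m : SimplexCategoryᵒᵖ} (y : (Y.lvl 0).El m) : y = (Y.lvl 0).pt m := by
  have := hY.2
  let f := (level 0).map ((isZero_zero SymSpec.{u}).to_ Y)
  have hy : ev f (ev (inv f) y) = y := ev_congr (IsIso.inv_hom_id f) y
  have h0 : ev (inv f) y = _ := eq_pt_of_isZero (isZero_zero SymSpec.{u}) _
  rw [← hy, h0]
  exact ev_pt f m

lemma isReedyFlatCofibrant {X : SimplicialObject SymSpec.{u}} (hX : IsGood X) :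
    IsReedyFlatCofibrant X
  | 0 => hX.flatCofibrant 0
  | n + 1 => isFlatCofibration_of_split (hX.flatCofibrant (n + 1)) _ (latchingMap_injective X n)
      (coprojection X n) (fun i => X.δ i.castSucc)
      (fun i => by
        rw [← Category.assoc, coprojection_latchingMap]
        exact X.δ_comp_σ_self)
      (exists_coprojection X n)

lemma isReedyPositiveFlatCofibrant {X : SimplicialObject SymSpec.{u}} (hX : IsPositiveGood X) :
    IsReedyPositiveFlatCofibrant X
  | 0 => hX.positiveFlatCofibrant 0
  | n + 1 => by
    refine ⟨isReedyFlatCofibrant hX.toIsGood (n + 1), isIso_of_subsingleton _ (fun m a => ?_)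
      fun m => eq_pt_of_isPositiveFlatCofibrant (hX.positiveFlatCofibrant (n + 1))⟩
    obtain ⟨i, x, rfl⟩ := exists_coprojection X n 0 m a
    rw [eq_pt_of_isPositiveFlatCofibrant (hX.positiveFlatCofibrant n) x]
    exact ev_pt (Hom.app (coprojection X n i) 0) m

end SymmetricSpectra

theorem theorem3p2 (X : CategoryTheory.SimplicialObject SymmetricSpectra.SymSpec.{u})
    (hX : SymmetricSpectra.IsGood X) :
    SymmetricSpectra.IsReedyFlatCofibrant X ∧
      (SymmetricSpectra.IsPositiveGood X → SymmetricSpectra.IsReedyPositiveFlatCofibrant X) :=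
  ⟨SymmetricSpectra.isReedyFlatCofibrant hX, SymmetricSpectra.isReedyPositiveFlatCofibrant⟩
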